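/- Let $C$ be a left cancellative monoid. Write $\tau_a\colon C\to aC$, $x\mapsto ax$, and $\sigma_a=\tau_a^{-1}$, regarded as partial bijections of $C$, and for $X\subseteq C$ put $aX=\{ax:x\in X\}$ and $a^{-1}X=\{x: ax\in X\}$. A zigzag is a tuple $\zeta=(\alpha_1,\beta_1,\dots,\alpha_n,\beta_n)$ of elements of $C$ with $n\ge 1$; put $\varphi_\zeta=\sigma_{\alpha_1}\tau_{\beta_1}\cdots\sigma_{\alpha_n}\tau_{\beta_n}$ and $A(\zeta)=\operatorname{dom}\varphi_\zeta=\beta_n^{-1}\alpha_n\cdots\beta_1^{-1}\alpha_1C$. Let $\mathrm{ZM}(C)$ be the inverse semigroup of partial bijections generated by all $\tau_a$ and the empty map, $\mathcal J(C)=\{A(\zeta)\}\cup\{\varnothing\}$, and $\mathcal J^{(\cup)}(C)$ the set of finite unions of members of $\mathcal J(C)$. For a family of partial isometries $v_a$ ($a\in C$) and projections $p_X$ in a $C^*$-algebra consider the relations - (L1) $v_a^*v_a=p_C$; (L2) $v_av_b=v_{ab}$; (L3) $p_\varnothing=0$; (L4) $p_Xp_Y=p_{X\cap Y}$; (L5)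 $v_ap_Xv_a^*=p_{aX}$; (L6) $p_{X\cup Y}=p_X+p_Y-p_Xp_Y$; - (L7) $v_{\alpha_1}^*v_{\beta_1}\cdots v_{\alpha_n}^*v_{\beta_n}=p_{A(\zeta)}$ whenever $\varphi_\zeta=\mathrm{id}_{A(\zeta)}$. Let $C^*_{\rm Li}(C)$ and $C^*_{{\rm Li},s}(C)$ be the universal $C^*$-algebras for (L1)–(L5) and for (L1)–(L3), (L7), respectively, with $X,Y$ ranging over $\mathcal J(C)$. Let $C^{*(\cup)}_{\rm Li}(C)$ and $C^{*(\cup)}_{{\rm Li},s}(C)$ be the universal $C^*$-algebras for (L1)–(L6) and for (L1)–(L3), (L6), (L7), respectively, with $X,Y$ ranging over $\mathcal J^{(\cup)}(C)$. Let $C^*(\mathrm{ZM}(C))$ be the universal $C^*$-algebra for zero-preserving $*$-representations of $\mathrm{ZM}(C)$, and let the Toeplitz algebra $\mathcal T(C)$ be the universal $C^*$-algebra for those representations $\pi$ that are finitely join-preserving, i.e. $\pi(\mathrm{id}_{A})=\bigvee_j\pi(\mathrm{id}_{A_j})$ whenever $A=\bigcup_{j=1}^nA_j$ with $A,A_j\in\mathcal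 J(C)$. There are canonical homomorphisms carrying generators to generators: $$\pi^{(\cup)}\colon C^*_{\rm Li}(C)\to C^{*(\cup)}_{\rm Li}(C),\quad \rho^{(\cup)}\colon C^*_{{\rm Li},s}(C)\to C^{*(\cup)}_{{\rm Li},s}(C),\quad q\colon C^*(\mathrm{ZM}(C))\to\mathcal T(C),\quad \pi_s\colon C^*_{\rm Li}(C)\to C^*_{{\rm Li},s}(C).$$ Call $C$ finitely aligned if for all $a,b\in C$ there is a finite, possibly empty, set $F\subseteq C$ with $aC\cap bC=\bigcup_{c\in F}cC$. **Proposition.** These maps are not injective in general, even for finitely aligned submonoids of groups: 1. There is a finitely aligned submonoid $C$ of a finitely generated free group, without invertible elements other than $1$, for which none of $\pi^{(\cup)}$, $\rho^{(\cup)}$ and $q$ is injective. 2. There is a finitely aligned submonoid $C$ of a finitely generated free group, without invertible elements other than $1$, for which $\pi_s$ is not injective. -/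

import Mathlib

open scoped ENNReal CStarAlgebra

noncomputable section

namespace LiAlgebras

/-! ### Universal C⋆-algebras given by generators and relations

The C⋆-algebras here are not assumed unital, and homomorphisms are `→⋆ₙₐ[ℂ]`. -/

/-- Relations on a family indexed by `X` in a C⋆-algebra, under which every member of the family
is a contraction. -/
structure Relations (X : Type) where
  /-- the family `f` in the C⋆-algebra `B` satisfies the relations -/
  Holds : ∀ (B : Type) [NonUnitalCStarAlgebra B], (X → B) → Prop
  norm_le_one : ∀ (B : Type) [NonUnitalCStarAlgebra B] (f : X → B), Holds B f → ∀ x, ‖f x‖ ≤ 1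

/-- A family in some C⋆-algebra satisfying the relations `R`. -/
structure Model {X : Type} (R : Relations X) where
  carrier : Type
  [inst : NonUnitalCStarAlgebra carrier]
  family : X → carrier
  holds : R.Holds carrier family

attribute [instance] Model.inst

/-- The product (bounded sections) of the C⋆-algebras of all models of `R`. -/
abbrev ModelProduct {X : Type} (R : Relations X) : Type 1 :=
  lp (fun M : Model R => M.carrier) ∞

/-- The family in the product whose coordinate at each model is the family of that model. -/
def productGen {X : Type} (R : Relations X) (x : X) : ModelProduct R :=
  ⟨fun M => M.family x, memℓp_infty ⟨1, by
    rintro _ ⟨M, rfl⟩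
    exact R.norm_le_one M.carrier M.family M.holds x⟩⟩

/-- The closed star subalgebra generated by the canonical family. -/
def universalSubalgebra {X : Type} (R : Relations X) :
    NonUnitalStarSubalgebra ℂ (ModelProduct R) :=
  (NonUnitalStarAlgebra.adjoin ℂ (Set.range (productGen R))).topologicalClosure

/-- The universal C⋆-algebra generated by a family indexed by `X` subject to the relations `R`. -/
def Universal {X : Type} (R : Relations X) : Type 1 := universalSubalgebra R

instance {X : Type} (R : Relations X) : NonUnitalCStarAlgebra (Universal R) :=
  NonUnitalStarSubalgebra.nonUnitalCStarAlgebra (universalSubalgebra R)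
    (h_closed := NonUnitalStarSubalgebra.isClosed_topologicalClosure _)

/-- The universal generators. -/
def Universal.gen {X : Type} (R : Relations X) (x : X) : Universal R :=
  ⟨productGen R x, NonUnitalStarSubalgebra.le_topologicalClosure _
    (NonUnitalStarAlgebra.subset_adjoin ℂ _ ⟨x, rfl⟩)⟩

/-- The coordinate of the universal C⋆-algebra at a model. -/
def Universal.toModel {X : Type} {R : Relations X} (M : Model R) :
    Universal R →⋆ₙₐ[ℂ] M.carrier where
  toFun a := (a.1 : ∀ M : Model R, M.carrier) M
  map_smul' _ _ := rfl
  map_zero' := rfl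
  map_add' _ _ := rfl
  map_mul' _ _ := rfl
  map_star' _ := rfl

/-- Two homomorphisms that agree on the universal generators are equal. -/
theorem Universal.hom_ext {X : Type} {R : Relations X} {B : Type*} [NonUnitalCStarAlgebra B]
    {φ ψ : Universal R →⋆ₙₐ[ℂ] B} (h : ∀ x, φ (gen R x) = ψ (gen R x)) : φ = ψ := by
  have key : ∀ (a : ModelProduct R)
      (ha : a ∈ NonUnitalStarAlgebra.adjoin ℂ (Set.range (productGen R))),
      φ ⟨a, NonUnitalStarSubalgebra.le_topologicalClosure _ ha⟩ =
        ψ ⟨a, NonUnitalStarSubalgebra.le_topologicalClosure _ ha⟩ := by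
    intro a ha
    induction ha using NonUnitalStarAlgebra.adjoin_induction with
    | mem x hx => obtain ⟨x, rfl⟩ := hx; exact h x
    | add x y hx hy ihx ihy =>
      exact ((map_add φ _ _).trans (congrArg₂ (· + ·) ihx ihy)).trans (map_add ψ _ _).symm
    | zero => exact (map_zero φ).trans (map_zero ψ).symm
    | mul x y hx hy ihx ihy =>
      exact ((map_mul φ _ _).trans (congrArg₂ (· * ·) ihx ihy)).trans (map_mul ψ _ _).symm
    | smul r x hx ihx =>
      exact ((map_smul φ r _).trans (congrArg (r • ·) ihx)).trans (map_smul ψ r _).symm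
    | star x hx ihx =>
      exact ((map_star φ _).trans (congrArg star ihx)).trans (map_star ψ _).symm
  have hφ : Continuous φ := map_continuous φ
  have hψ : Continuous ψ := map_continuous ψ
  ext ⟨a, ha⟩
  obtain ⟨u, hu, hlim⟩ := mem_closure_iff_seq_limit.1 (show a ∈ closure _ from ha)
  let w : ℕ → Universal R := fun n => ⟨u n, NonUnitalStarSubalgebra.le_topologicalClosure _ (hu n)⟩
  have hw : Filter.Tendsto w Filter.atTop (nhds (⟨a, ha⟩ : Universal R)) :=
    tendsto_subtype_rng.2 hlim
  have h1 := (hφ.tendsto _).comp hw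
  have h2 := (hψ.tendsto _).comp hw
  have : φ ∘ w = ψ ∘ w := funext fun n => key _ (hu n)
  rw [this] at h1
  exact tendsto_nhds_unique h1 h2

/-- The universal property. -/
theorem Universal.existsUnique_lift {X : Type} {R : Relations X} {B : Type}
    [NonUnitalCStarAlgebra B] (f : X → B) (hf : R.Holds B f) :
    ∃! φ : Universal R →⋆ₙₐ[ℂ] B, ∀ x, φ (gen R x) = f x :=
  ⟨toModel ⟨B, f, hf⟩, fun _ => rfl, fun _ hψ => hom_ext fun x => hψ x⟩

/-- Formal star polynomials (without constant term) in the variables `X`. -/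
inductive StarPoly (X : Type) : Type
  | gen : X → StarPoly X
  | zero : StarPoly X
  | add : StarPoly X → StarPoly X → StarPoly X
  | mul : StarPoly X → StarPoly X → StarPoly X
  | smul : ℂ → StarPoly X → StarPoly X
  | star : StarPoly X → StarPoly X

/-- Evaluation of a star polynomial at a family in a C⋆-algebra. -/
def StarPoly.eval {X : Type} {B : Type*} [NonUnitalCStarAlgebra B] (f : X → B) : StarPoly X → B
  | gen x => f x
  | zero => 0
  | add s t => s.eval f + t.eval f
  | mul s t => s.eval f * t.eval f
  | smul c t => c • t.eval f
  | star t => Star.star (t.eval f)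

/-- Every family indexed by a type in `Type` in a C⋆-algebra of any universe comes from a
C⋆-algebra in `Type`; so nothing is lost by taking the C⋆-algebras of `Model` in `Type`. -/
theorem exists_small_model {X : Type} {B : Type*} [NonUnitalCStarAlgebra B] (f : X → B) :
    ∃ (B' : Type) (_ : NonUnitalCStarAlgebra B') (f' : X → B') (ι : B' →⋆ₙₐ[ℂ] B),
      Isometry ι ∧ ∀ x, ι (f' x) = f x := by
  classical
  let S : NonUnitalStarSubalgebra ℂ B := NonUnitalStarAlgebra.adjoin ℂ (Set.range f)
  have hS : ∀ b ∈ S, ∃ t : StarPoly X, t.eval f = b := by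
    intro b hb
    induction hb using NonUnitalStarAlgebra.adjoin_induction with
    | mem x hx => obtain ⟨x, rfl⟩ := hx; exact ⟨.gen x, rfl⟩
    | add x y hx hy ihx ihy =>
      obtain ⟨s, rfl⟩ := ihx
      obtain ⟨t, rfl⟩ := ihy
      exact ⟨.add s t, rfl⟩
    | zero => exact ⟨.zero, rfl⟩
    | mul x y hx hy ihx ihy =>
      obtain ⟨s, rfl⟩ := ihx
      obtain ⟨t, rfl⟩ := ihy
      exact ⟨.mul s t, rfl⟩
    | smul r x hx ihx =>
      obtain ⟨s, rfl⟩ := ihx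
      exact ⟨.smul r s, rfl⟩
    | star x hx ihx =>
      obtain ⟨s, rfl⟩ := ihx
      exact ⟨.star s, rfl⟩
  let D : NonUnitalStarSubalgebra ℂ B := S.topologicalClosure
  let instD : NonUnitalCStarAlgebra D :=
    NonUnitalStarSubalgebra.nonUnitalCStarAlgebra D
      (h_closed := NonUnitalStarSubalgebra.isClosed_topologicalClosure _)
  have hD : ∀ d : D, ∃ t : ℕ → StarPoly X,
      Filter.Tendsto (fun n => (t n).eval f) Filter.atTop (nhds (d : B)) := by
    rintro ⟨d, hd⟩
    obtain ⟨u, hu, hlim⟩ := mem_closure_iff_seq_limit.1 (show d ∈ closure (S : Set B) from hd)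
    choose t ht using fun n => hS (u n) (hu n)
    exact ⟨t, by simpa only [ht] using hlim⟩
  choose t ht using hD
  have : Small.{0} D := small_of_injective (f := t) fun a b hab => by
    have h := ht a
    rw [hab] at h
    exact Subtype.ext (tendsto_nhds_unique h (ht b))
  let e : Shrink.{0} D ≃ D := (equivShrink D).symm
  let er : Shrink.{0} D ≃+* D := Shrink.ringEquiv D
  let i1 : NonUnitalNormedRing (Shrink.{0} D) :=
    NonUnitalNormedRing.induced (Shrink.{0} D) D er er.injective
  let el : Shrink.{0} D ≃ₗ[ℂ] D := Shrink.linearEquiv ℂ D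
  let i2 : NormedSpace ℂ (Shrink.{0} D) := NormedSpace.induced ℂ (Shrink.{0} D) D el
  have hiso : Isometry e := Isometry.of_dist_eq fun x y => rfl
  have hadd : ∀ x y : Shrink.{0} D, e (x + y) = e x + e y := map_add er
  have hmul : ∀ x y : Shrink.{0} D, e (x * y) = e x * e y := map_mul er
  have hsmul : ∀ (c : ℂ) (x : Shrink.{0} D), e (c • x) = c • e x := map_smul el
  have hnorm : ∀ x : Shrink.{0} D, ‖x‖ = ‖e x‖ := fun _ => rfl
  let i3 : StarRing (Shrink.{0} D) :=
    { star := fun x => e.symm (star (e x))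
      star_involutive := fun x => by
        show e.symm (star (e (e.symm (star (e x))))) = x
        simp
      star_mul := fun x y => e.injective <| by
        show e (e.symm (star (e (x * y)))) = e (e.symm (star (e y)) * e.symm (star (e x)))
        simp only [hmul, e.apply_symm_apply, star_mul]
      star_add := fun x y => e.injective <| by
        show e (e.symm (star (e (x + y)))) = e (e.symm (star (e x)) + e.symm (star (e y)))
        simp only [hadd, e.apply_symm_apply, star_add] }
  have hstar : ∀ x : Shrink.{0} D, e (star x) = star (e x) := fun x => e.apply_symm_apply _
  let i4 : NonUnitalCStarAlgebra (Shrink.{0} D) :=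
    { i1, i2, i3 with
      complete := ((IsometryEquiv.mk e hiso).completeSpace_iff.2 inferInstance).complete
      norm_mul_self_le := fun x => by
        rw [hnorm, hnorm (star x * x), hmul, hstar]
        exact CStarRing.norm_mul_self_le (e x)
      smul_assoc := fun c x y => e.injective <| by
        simp only [smul_eq_mul, hmul, hsmul, smul_mul_assoc]
      smul_comm := fun c x y => e.injective <| by
        simp only [smul_eq_mul, hmul, hsmul, mul_smul_comm]
      star_smul := fun c x => e.injective <| by
        simp only [hstar, hsmul, star_smul] }
  refine ⟨Shrink.{0} D, i4, fun x => e.symm ⟨f x, ?_⟩,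
    { toFun := fun x => (e x : B)
      map_smul' := fun c x => congrArg Subtype.val (map_smul el c x)
      map_zero' := congrArg Subtype.val (map_zero er)
      map_add' := fun x y => congrArg Subtype.val (map_add er x y)
      map_mul' := fun x y => congrArg Subtype.val (map_mul er x y)
      map_star' := fun x => congrArg Subtype.val (hstar x) }, ?_, ?_⟩
  · exact NonUnitalStarSubalgebra.le_topologicalClosure _
      (NonUnitalStarAlgebra.subset_adjoin ℂ _ ⟨x, rfl⟩)
  · exact Isometry.of_dist_eq fun x y => rfl
  · intro x
    exact congrArg Subtype.val (e.apply_symm_apply _)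

/-! ### Left cancellative monoids, zigzags and constructible right ideals

A left cancellative monoid is a left cancellative small category with one vertex, so all pairs are
composable and `s(α)C = C` for every `α`. -/

section Monoid

variable {C : Type} [Monoid C]

/-- For all `a, b` the right ideal `aC ∩ bC` is generated by a finite (possibly empty) set. -/
def IsFinitelyAligned (C : Type) [Monoid C] : Prop :=
  ∀ a b : C, ∃ F : Finset C,
    Set.range (a * ·) ∩ Set.range (b * ·) = ⋃ c ∈ F, Set.range (c * ·)

/-- The only invertible element is the unit. -/
def HasNoInverses (C : Type) [Monoid C] : Prop :=
  ∀ a b : C, a * b = 1 → a = 1 ∧ b = 1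

/-- Zigzags `(α₁, β₁, …, αₙ, βₙ)` with `n ≥ 1`: `single a b` is `(a, b)` and `cons a b ζ` is `(a, b)`
followed by `ζ`. -/
inductive Zigzag (C : Type) : Type
  | single : C → C → Zigzag C
  | cons : C → C → Zigzag C → Zigzag C

/-- `a X` -/
def leftMul (a : C) (X : Set C) : Set C := (a * ·) '' X

/-- `a⁻¹ X` -/
def leftDiv (a : C) (X : Set C) : Set C := {x | a * x ∈ X}

/-- `βₙ⁻¹ αₙ ⋯ β₁⁻¹ α₁ X` -/
def Zigzag.pull : Zigzag C → Set C → Set C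
  | single a b, X => leftDiv b (leftMul a X)
  | cons a b ζ, X => ζ.pull (leftDiv b (leftMul a X))

/-- `A(ζ) = βₙ⁻¹ αₙ ⋯ β₁⁻¹ α₁ C` -/
def Zigzag.A (ζ : Zigzag C) : Set C := ζ.pull Set.univ

/-- The constructible right ideals. -/
def J (C : Type) [Monoid C] : Set (Set C) := Set.range (Zigzag.A : Zigzag C → Set C) ∪ {∅}

/-- The finite unions of constructible right ideals. -/
def JU (C : Type) [Monoid C] : Set (Set C) := {X | ∃ F : Set (Set C), F.Finite ∧ F ⊆ J C ∧ X = ⋃₀ F}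

theorem J_subset_JU (C : Type) [Monoid C] : J C ⊆ JU C := fun X hX =>
  ⟨{X}, Set.finite_singleton X, Set.singleton_subset_iff.2 hX, (Set.sUnion_singleton X).symm⟩

/-! ### Partial bijections and the zigzag inverse semigroup -/

open Classical in
/-- The partial bijection `τ_a : C → aC`, `x ↦ a x`. -/
def tau [IsLeftCancelMul C] (a : C) : C ≃. C where
  toFun x := some (a * x)
  invFun y := if h : ∃ x, a * x = y then some h.choose else none
  inv x y := by
    constructor
    · intro h
      by_cases hy : ∃ x, a * x = y
      · rw [dif_pos hy] at h
        have hx : hy.choose = x := Option.some.inj h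
        exact congrArg some (hx ▸ hy.choose_spec)
      · rw [dif_neg hy] at h
        cases h
    · intro h
      have h' : a * x = y := Option.some.inj h
      have hy : ∃ x, a * x = y := ⟨x, h'⟩
      rw [dif_pos hy]
      exact congrArg some (mul_left_cancel (hy.choose_spec.trans h'.symm))

/-- The partial bijection `σ_a : aC → C`, the inverse of `τ_a`. -/
def sigma [IsLeftCancelMul C] (a : C) : C ≃. C := (tau a).symm

/-- The product of partial bijections: `comp f g` is `g` followed by `f`. -/
def comp (f g : C ≃. C) : C ≃. C := g.trans f

/-- The zigzag map `φ_ζ = σ_{α₁} τ_{β₁} ⋯ σ_{αₙ} τ_{βₙ}`. -/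
def Zigzag.map [IsLeftCancelMul C] : Zigzag C → (C ≃. C)
  | single a b => comp (sigma a) (tau b)
  | cons a b ζ => comp (comp (sigma a) (tau b)) ζ.map

/-- Membership in the semigroup of partial bijections generated by the `τ_a`, their inverses `σ_a`
and the empty map. -/
inductive InZM [IsLeftCancelMul C] : (C ≃. C) → Prop
  | bot : InZM ⊥
  | tau (a : C) : InZM (tau a)
  | sigma (a : C) : InZM (sigma a)
  | comp {f g : C ≃. C} : InZM f → InZM g → InZM (comp f g)

theorem InZM.symm [IsLeftCancelMul C] {f : C ≃. C} (hf : InZM f) : InZM f.symm := by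
  induction hf with
  | bot => rw [PEquiv.symm_bot]; exact bot
  | tau a => exact sigma a
  | sigma a => exact tau a
  | @comp f g _ _ ihf ihg =>
    have : (LiAlgebras.comp f g).symm = LiAlgebras.comp g.symm f.symm := PEquiv.symm_trans_rev g f
    rw [this]
    exact comp ihg ihf

/-- The inverse semigroup `ZM(C)` of zigzag maps; `star` is the inverse, `0` is the empty map. -/
def ZM (C : Type) [Monoid C] [IsLeftCancelMul C] : Type := {f : C ≃. C // InZM f}

instance [IsLeftCancelMul C] : Mul (ZM C) := ⟨fun s t => ⟨comp s.1 t.1, s.2.comp t.2⟩⟩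
instance [IsLeftCancelMul C] : Star (ZM C) := ⟨fun s => ⟨s.1.symm, s.2.symm⟩⟩
instance [IsLeftCancelMul C] : Zero (ZM C) := ⟨⟨⊥, .bot⟩⟩

/-- The domain of a zigzag map. -/
def ZM.dom [IsLeftCancelMul C] (s : ZM C) : Set C := {x | (s.1 x).isSome}

theorem ZM.mul_star_mul [IsLeftCancelMul C] (s : ZM C) : s * star s * s = s := by
  apply Subtype.ext
  show s.1.trans (s.1.symm.trans s.1) = s.1
  apply PEquiv.ext
  intro x
  show (s.1 x).bind (fun y => (s.1.symm y).bind s.1) = s.1 x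
  cases h : s.1 x with
  | none => rfl
  | some y =>
    show (s.1.symm y).bind s.1 = some y
    rw [(PEquiv.eq_some_iff s.1).2 h]
    exact h

/-! ### Relations -/

variable {B : Type*} [NonUnitalCStarAlgebra B]

/-- `v_{α₁}* v_{β₁} ⋯ v_{αₙ}* v_{βₙ}` -/
def Zigzag.word (v : C → B) : Zigzag C → B
  | single a b => star (v a) * v b
  | cons a b ζ => star (v a) * v b * ζ.word v

/-- Partial isometries `v_a` and projections `p_X`, `X ∈ 𝒥`, with `v_a* v_a = p_C`,
`v_a v_b = v_{ab}` and `p_∅ = 0`. -/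
structure LiBase (𝒥 : Set (Set C)) (v : C → B) (p : 𝒥 → B) : Prop where
  partialIsometry : ∀ a, v a * star (v a) * v a = v a
  projection : ∀ X, IsStarProjection (p X)
  L1 : ∀ (a : C) (X : 𝒥), X.1 = Set.univ → star (v a) * v a = p X
  L2 : ∀ a b, v a * v b = v (a * b)
  L3 : ∀ X : 𝒥, X.1 = ∅ → p X = 0

/-- `p_X p_Y = p_{X ∩ Y}` -/
def L4 (𝒥 : Set (Set C)) (p : 𝒥 → B) : Prop :=
  ∀ X Y Z : 𝒥, Z.1 = X.1 ∩ Y.1 → p X * p Y = p Z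

/-- `v_a p_X v_a* = p_{aX}` -/
def L5 (𝒥 : Set (Set C)) (v : C → B) (p : 𝒥 → B) : Prop :=
  ∀ (a : C) (X Y : 𝒥), Y.1 = leftMul a X.1 → v a * p X * star (v a) = p Y

/-- `p_{X ∪ Y} = p_X ∨ p_Y` -/
def L6 (𝒥 : Set (Set C)) (p : 𝒥 → B) : Prop :=
  ∀ X Y Z : 𝒥, Z.1 = X.1 ∪ Y.1 → p Z = p X + p Y - p X * p Y

open Classical in
/-- If `φ_ζ` is the identity of `A(ζ)` then `v_{α₁}* v_{β₁} ⋯ v_{αₙ}* v_{βₙ} = p_{A(ζ)}`. -/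
def L7 [IsLeftCancelMul C] (𝒥 : Set (Set C)) (v : C → B) (p : 𝒥 → B) : Prop :=
  ∀ (ζ : Zigzag C) (X : 𝒥), X.1 = ζ.A → ζ.map = PEquiv.ofSet ζ.A → ζ.word v = p X

/-- Representations of the inverse semigroup `ZM(C)`. -/
structure IsZMRep [IsLeftCancelMul C] (π : ZM C → B) : Prop where
  mul : ∀ s t, π (s * t) = π s * π t
  star : ∀ s, π (star s) = star (π s)
  zero : π 0 = 0

/-- The join `e₁ ∨ ⋯ ∨ eₙ` of finitely many commuting projections, where
`e ∨ f = e + f - e f`; the empty join is `0`. -/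
def projJoin : List B → B
  | [] => 0
  | e :: l => e + projJoin l - e * projJoin l

/-- Whenever the domain of `s` is a finite union of domains of zigzag maps `s₁, …, sₙ`, the
projection `π(s)* π(s) = π(id_{dom s})` is the join of the projections `π(sⱼ)* π(sⱼ)`. -/
def IsFinitelyJoinPreserving [IsLeftCancelMul C] (π : ZM C → B) : Prop :=
  ∀ (s : ZM C) (l : List (ZM C)), (∀ x, x ∈ s.dom ↔ ∃ t ∈ l, x ∈ t.dom) →
    π (star s * s) = projJoin (l.map fun t => π (star t * t))

theorem norm_le_one_of_partialIsometry {a : B} (h : a * star a * a = a) : ‖a‖ ≤ 1 := by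
  have h1 : star a * a * (star a * a) = star a * a := by
    rw [mul_assoc, ← mul_assoc a, h]
  have h2 : ‖star a * a * (star a * a)‖ = ‖star a * a‖ * ‖star a * a‖ := by
    have := CStarRing.norm_star_mul_self (x := star a * a)
    rwa [star_mul, star_star] at this
  rw [h1, CStarRing.norm_star_mul_self] at h2
  by_contra hlt
  push Not at hlt
  have h3 : 1 < ‖a‖ * ‖a‖ := by nlinarith
  nlinarith

theorem LiBase.norm_le_one {𝒥 : Set (Set C)} {f : C ⊕ 𝒥 → B}
    (h : LiBase 𝒥 (f ∘ Sum.inl) (f ∘ Sum.inr)) (x : C ⊕ 𝒥) : ‖f x‖ ≤ 1 := by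
  apply norm_le_one_of_partialIsometry
  cases x with
  | inl a => exact h.partialIsometry a
  | inr X =>
    have hX : IsStarProjection (f (Sum.inr X)) := h.projection X
    rw [hX.isSelfAdjoint.star_eq, hX.isIdempotentElem.eq, hX.isIdempotentElem.eq]

theorem IsZMRep.norm_le_one [IsLeftCancelMul C] {π : ZM C → B} (h : IsZMRep π) (s : ZM C) :
    ‖π s‖ ≤ 1 := by
  apply norm_le_one_of_partialIsometry
  rw [← h.star, ← h.mul, ← h.mul, ZM.mul_star_mul]

end Monoid

/-! ### The C⋆-algebras -/

section Algebras

variable (C : Type) [Monoid C] [IsLeftCancelMul C]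

/-- (L1) – (L5) over `𝒥(C)` -/
def liRel : Relations (C ⊕ J C) where
  Holds _ _ f := LiBase (J C) (f ∘ Sum.inl) (f ∘ Sum.inr) ∧ L4 (J C) (f ∘ Sum.inr) ∧
    L5 (J C) (f ∘ Sum.inl) (f ∘ Sum.inr)
  norm_le_one _ _ _ h := h.1.norm_le_one

/-- (L1) – (L6) over the finite unions of constructible right ideals -/
def liURel : Relations (C ⊕ JU C) where
  Holds _ _ f := LiBase (JU C) (f ∘ Sum.inl) (f ∘ Sum.inr) ∧ L4 (JU C) (f ∘ Sum.inr) ∧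
    L5 (JU C) (f ∘ Sum.inl) (f ∘ Sum.inr) ∧ L6 (JU C) (f ∘ Sum.inr)
  norm_le_one _ _ _ h := h.1.norm_le_one

/-- (L1) – (L3) and (L7) over `𝒥(C)` -/
def liSRel : Relations (C ⊕ J C) where
  Holds _ _ f := LiBase (J C) (f ∘ Sum.inl) (f ∘ Sum.inr) ∧
    L7 (J C) (f ∘ Sum.inl) (f ∘ Sum.inr)
  norm_le_one _ _ _ h := h.1.norm_le_one

/-- (L1) – (L3), (L6) and (L7) over the finite unions of constructible right ideals -/
def liSURel : Relations (C ⊕ JU C) where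
  Holds _ _ f := LiBase (JU C) (f ∘ Sum.inl) (f ∘ Sum.inr) ∧ L6 (JU C) (f ∘ Sum.inr) ∧
    L7 (JU C) (f ∘ Sum.inl) (f ∘ Sum.inr)
  norm_le_one _ _ _ h := h.1.norm_le_one

/-- Representations of `ZM(C)` -/
def zmRel : Relations (ZM C) where
  Holds _ _ π := IsZMRep π
  norm_le_one _ _ _ h := h.norm_le_one

/-- Finitely join-preserving representations of `ZM(C)` -/
def toeplitzRel : Relations (ZM C) where
  Holds _ _ π := IsZMRep π ∧ IsFinitelyJoinPreserving π
  norm_le_one _ _ _ h := h.1.norm_le_one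

/-- `C*_Li(C)` -/
abbrev CLi : Type 1 := Universal (liRel C)

/-- `C*_Li^(∪)(C)` -/
abbrev CLiU : Type 1 := Universal (liURel C)

/-- `C*_{Li,s}(C)` -/
abbrev CLiS : Type 1 := Universal (liSRel C)

/-- `C*_{Li,s}^(∪)(C)` -/
abbrev CLiSU : Type 1 := Universal (liSURel C)

/-- `C*(ZM(C))` -/
abbrev CZM : Type 1 := Universal (zmRel C)

/-- The Toeplitz algebra `𝒯(C)`, universal for the finitely join-preserving representations of
`ZM(C)` -/
abbrev Toeplitz : Type 1 := Universal (toeplitzRel C)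

variable {C}

/-- `π^(∪)` is the homomorphism with `v_a ↦ v_a` and `p_X ↦ p_X`. -/
def IsPiU (π : CLi C →⋆ₙₐ[ℂ] CLiU C) : Prop :=
  (∀ a : C, π (.gen _ (.inl a)) = .gen _ (.inl a)) ∧
  ∀ X : J C, π (.gen _ (.inr X)) = .gen _ (.inr ⟨X.1, J_subset_JU C X.2⟩)

/-- `ρ^(∪)` is the homomorphism with `v_a ↦ v_a` and `p_X ↦ p_X`. -/
def IsRhoU (ρ : CLiS C →⋆ₙₐ[ℂ] CLiSU C) : Prop :=
  (∀ a : C, ρ (.gen _ (.inl a)) = .gen _ (.inl a)) ∧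
  ∀ X : J C, ρ (.gen _ (.inr X)) = .gen _ (.inr ⟨X.1, J_subset_JU C X.2⟩)

/-- `q` is the homomorphism carrying the universal representation of `ZM(C)` to the universal
finitely join-preserving one. -/
def IsQ (q : CZM C →⋆ₙₐ[ℂ] Toeplitz C) : Prop :=
  ∀ s : ZM C, q (.gen _ s) = .gen _ s

/-- `π_s` is the homomorphism with `v_a ↦ v_a` and `p_X ↦ p_X`. -/
def IsPiS (π : CLi C →⋆ₙₐ[ℂ] CLiS C) : Prop :=
  ∀ x : C ⊕ J C, π (.gen _ x) = .gen _ x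

end Algebras

end LiAlgebras

end

/-! Both parts use one monoid $C$, generated in the free group on $h,\alpha_1,\alpha_2,c,d$ by
$\alpha_i,\alpha_ih,c,d,hc,hd$. Here $h\notin C$, and $\alpha_ihx\in\alpha_iC$ iff $hx\in C$ iff
$x\in cC\cup dC$. So the constructible ideal $X=A(\alpha_1,\alpha_1h)$ is the union of two
constructible ideals, neither of which contains the other (`A_eq_union`).

In the targets of $\pi^{(\cup)}$, $\rho^{(\cup)}$ and $q$ the projection of $X$ is therefore the
join of those of $cC$ and $dC$. To refute this in the sources, let $C$ act diagonally on $C\times C$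
and send $p_Y$ to the projection onto $\ell^2(Y\times Y)$. Squaring respects products, inverses and
intersections but not unions: $(c,d)$ lies in $X\times X$ and in neither smaller square
(`shift_idOn_prod_ne`).

For $\pi_s$, the zigzag $(\alpha_2h,\alpha_2,\alpha_1,\alpha_1h)$ acts by $x\mapsto\alpha_1hx\mapsto
hx\mapsto\alpha_2hx\mapsto x$, the identity of $X$, so (L7) makes its word equal to $p_X$. On pairs,
this loop takes $(c,d)$ through $(hc,hd)$, whose entries have no common left factor in $C$ except
$1$. Hence the diagonal action lifts to a double cover of $C\times C$ in which the sheets over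
$(hc,hd)$ are exchanged exactly by elements ending in $\alpha_2$ (`twist_twist`). The projections do
not see the sheets, so (L1)–(L5) survive, but the loop exchanges the sheets over $(c,d)$ and its
word is not $p_X$ (`not_injective_of_isPiS`).

Finite alignment (`range_inter_of_prefix`) comes from an automaton recognising the positive words
that lie in $C$. -/

noncomputable section

namespace LiAlgebras

/-! ### Homomorphisms between universal C⋆-algebras -/

/-- A map of generators under which the relations `R'` imply the relations `R` induces a
homomorphism of the products of all models. -/
def ModelProduct.comap {X Y : Type} {R : Relations X} {R' : Relations Y} (g : X → Y)
    (h : ∀ (B : Type) [NonUnitalCStarAlgebra B] (f : Y → B), R'.Holds B f → R.Holds B (f ∘ g)) :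
    ModelProduct R →⋆ₙₐ[ℂ] ModelProduct R' where
  toFun a := ⟨fun M => (a : ∀ M : Model R, M.carrier) ⟨M.carrier, M.family ∘ g, h _ _ M.holds⟩,
    memℓp_infty ⟨‖a‖, by
      rintro _ ⟨M, rfl⟩
      exact lp.norm_apply_le_norm ENNReal.top_ne_zero a
        ⟨M.carrier, M.family ∘ g, h _ _ M.holds⟩⟩⟩
  map_smul' _ _ := rfl
  map_zero' := rfl
  map_add' _ _ := rfl
  map_mul' _ _ := rfl
  map_star' _ := rfl

/-- Generators go to generators, and continuity handles the closure. Coordinates are reindexed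
directly because `Universal.existsUnique_lift` only reaches targets in `Type`, while universal
algebras live in `Type 1`. -/
theorem ModelProduct.comap_mem {X Y : Type} {R : Relations X} {R' : Relations Y} (g : X → Y)
    (h : ∀ (B : Type) [NonUnitalCStarAlgebra B] (f : Y → B), R'.Holds B f → R.Holds B (f ∘ g))
    {a : ModelProduct R} (ha : a ∈ universalSubalgebra R) :
    ModelProduct.comap g h a ∈ universalSubalgebra R' := by
  have hc : Continuous (ModelProduct.comap g h) := map_continuous _
  have hmaps : Set.MapsTo (ModelProduct.comap g h)
      (NonUnitalStarAlgebra.adjoin ℂ (Set.range (productGen R)) : Set (ModelProduct R))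
      (NonUnitalStarAlgebra.adjoin ℂ (Set.range (productGen R')) : Set (ModelProduct R')) := by
    intro a ha
    induction ha using NonUnitalStarAlgebra.adjoin_induction with
    | mem x hx =>
      obtain ⟨x, rfl⟩ := hx
      exact NonUnitalStarAlgebra.subset_adjoin ℂ _ ⟨g x, rfl⟩
    | add x y hx hy ihx ihy => rw [map_add]; exact add_mem ihx ihy
    | zero => rw [map_zero]; exact zero_mem _
    | mul x y hx hy ihx ihy => rw [map_mul]; exact mul_mem ihx ihy
    | smul r x hx ihx => rw [map_smul]; exact SMulMemClass.smul_mem r ihx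
    | star x hx ihx => rw [map_star]; exact star_mem ihx
  exact hmaps.closure hc ha

/-- A map of generators under which the relations `R'` imply the relations `R` induces a
homomorphism of universal C⋆-algebras. -/
def Universal.map {X Y : Type} {R : Relations X} {R' : Relations Y} (g : X → Y)
    (h : ∀ (B : Type) [NonUnitalCStarAlgebra B] (f : Y → B), R'.Holds B f → R.Holds B (f ∘ g)) :
    Universal R →⋆ₙₐ[ℂ] Universal R' where
  toFun a := ⟨ModelProduct.comap g h a.1, ModelProduct.comap_mem g h a.2⟩
  map_smul' _ _ := rfl
  map_zero' := rfl
  map_add' _ _ := rfl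
  map_mul' _ _ := rfl
  map_star' _ := rfl

/-- The models separate the points of the universal C⋆-algebra. -/
theorem Universal.ext_model {X : Type} {R : Relations X} {a b : Universal R}
    (h : ∀ M : Model R, toModel M a = toModel M b) : a = b :=
  Subtype.ext (lp.ext (funext h))

/-! ### Operators of partial bijections -/

section Operators

variable {Ω : Type}

/-- The Hilbert space `ℓ²(Ω)`. -/
abbrev EllTwo (Ω : Type) : Type := lp (fun _ : Ω => ℂ) 2

/-- The terms off the range of `f` vanish and the others are reindexed injectively by their
preimages. This makes `shift f` a contraction. -/
theorem sum_elim_le (f : Ω ≃. Ω) (g : Ω → ℝ) (s : Finset Ω) :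
    ∃ t : Finset Ω, ∑ y ∈ s, (f.symm y).elim 0 g = ∑ x ∈ t, g x := by
  refine ⟨s.filterMap f.symm fun a b c ha hb => f.symm.inj ha hb, ?_⟩
  refine Finset.sum_bij_ne_zero
    (fun a _ h => (f.symm a).get (by
      by_contra hn
      rw [Option.not_isSome_iff_eq_none] at hn
      simp [hn] at h)) ?_ ?_ ?_ ?_
  · intro a ha h
    rw [Finset.mem_filterMap]
    exact ⟨a, ha, by simp⟩
  · intro a ha h a' ha' h' e
    have h1 := Option.get_mem (o := f.symm a) (by
      by_contra hn
      rw [Option.not_isSome_iff_eq_none] at hn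
      simp [hn] at h)
    rw [e] at h1
    exact f.symm.inj h1 (Option.get_mem _)
  · intro b hb hg
    rw [Finset.mem_filterMap] at hb
    obtain ⟨a, ha, hab⟩ := hb
    refine ⟨a, ha, by simpa [hab] using hg, by simp [hab]⟩
  · intro a ha h
    exact congrArg (Option.elim · 0 g) (Option.some_get _).symm

theorem sum_norm_elim_le (f : Ω ≃. Ω) (ξ : EllTwo Ω) (s : Finset Ω) :
    ∑ y ∈ s, ‖(f.symm y).elim 0 ξ‖ ^ (2 : ℝ≥0∞).toReal ≤ ‖ξ‖ ^ (2 : ℝ≥0∞).toReal := by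
  obtain ⟨t, ht⟩ := sum_elim_le f (fun x => ‖ξ x‖ ^ (2 : ℝ≥0∞).toReal) s
  calc _ = ∑ y ∈ s, (f.symm y).elim 0 (fun x => ‖ξ x‖ ^ (2 : ℝ≥0∞).toReal) := by
        refine Finset.sum_congr rfl fun y _ => ?_
        cases f.symm y <;> simp
    _ = _ := ht
    _ ≤ _ := lp.sum_rpow_le_norm_rpow (by simp) ξ t

/-- The partial isometry of `ℓ²(Ω)` with `δ_x ↦ δ_{f x}` on the domain of `f` and `δ_x ↦ 0` off
it. -/
def shift (f : Ω ≃. Ω) : EllTwo Ω →L[ℂ] EllTwo Ω :=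
  LinearMap.mkContinuous
    { toFun := fun ξ => ⟨fun y => (f.symm y).elim 0 ξ, memℓp_gen' (sum_norm_elim_le f ξ)⟩
      map_add' := fun ξ η => lp.ext <| funext fun y => by
        change (f.symm y).elim (0 : ℂ) (fun x => ξ x + η x) =
          (f.symm y).elim (0 : ℂ) ξ + (f.symm y).elim (0 : ℂ) η
        cases f.symm y <;> simp
      map_smul' := fun c ξ => lp.ext <| funext fun y => by
        change (f.symm y).elim (0 : ℂ) (fun x => c • ξ x) = c • (f.symm y).elim (0 : ℂ) ξ
        cases f.symm y <;> simp } 1 fun ξ => by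
    rw [one_mul]
    exact lp.norm_le_of_forall_sum_le (by simp) (norm_nonneg _) (sum_norm_elim_le f ξ)

theorem shift_apply (f : Ω ≃. Ω) (ξ : EllTwo Ω) (y : Ω) :
    shift f ξ y = (f.symm y).elim 0 ξ := rfl

theorem shift_trans (f g : Ω ≃. Ω) : shift (f.trans g) = shift g * shift f := by
  ext ξ y
  change ((g.symm y).bind f.symm).elim 0 ξ = (g.symm y).elim 0 (shift f ξ)
  cases g.symm y <;> simp [shift_apply]

theorem shift_bot : shift (⊥ : Ω ≃. Ω) = 0 := by
  ext ξ y
  simp [shift_apply]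

open Classical in
/-- The standard basis vector `δ_x`. -/
def delta (x : Ω) : EllTwo Ω := lp.single 2 x 1

theorem delta_apply_self (x : Ω) : delta x x = 1 := by
  simp [delta]

theorem delta_apply_of_ne {x y : Ω} (h : y ≠ x) : delta x y = 0 := by
  simp [delta, lp.single_apply, h]

theorem inner_delta_left (x : Ω) (ξ : EllTwo Ω) : inner ℂ (delta x) ξ = ξ x := by
  classical
  rw [delta, lp.inner_single_left]
  simp

theorem shift_delta_of_eq_some {f : Ω ≃. Ω} {x y : Ω} (h : f x = some y) :
    shift f (delta x) = delta y := by
  ext z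
  rw [shift_apply]
  by_cases hz : z = y
  · subst hz
    rw [(PEquiv.eq_some_iff f).2 h]
    exact (delta_apply_self x).trans (delta_apply_self z).symm
  · rw [delta_apply_of_ne hz]
    cases hw : f.symm z with
    | none => rfl
    | some w =>
      refine delta_apply_of_ne fun e => hz ?_
      rw [PEquiv.eq_some_iff, e, h] at hw
      exact (Option.some.inj hw).symm

theorem shift_delta_of_eq_none {f : Ω ≃. Ω} {x : Ω} (h : f x = none) :
    shift f (delta x) = 0 := by
  ext z
  rw [shift_apply]
  cases hw : f.symm z with
  | none => rfl
  | some w =>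
    refine delta_apply_of_ne fun e => ?_
    rw [PEquiv.eq_some_iff, e, h] at hw
    cases hw

/-- Coordinates are inner products with basis vectors, so the adjoint is determined by the action of
`shift f` on each `delta x`. -/
theorem shift_symm (f : Ω ≃. Ω) : shift f.symm = star (shift f) := by
  ext ξ x
  have h1 : inner ℂ (delta x) (star (shift f) ξ) = inner ℂ (shift f (delta x)) ξ :=
    ContinuousLinearMap.adjoint_inner_right _ _ _
  rw [inner_delta_left] at h1
  rw [h1, shift_apply, PEquiv.symm_symm]
  cases h : f x with
  | none => simp [shift_delta_of_eq_none h]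
  | some y => rw [shift_delta_of_eq_some h, inner_delta_left]; rfl

theorem delta_ne_zero (x : Ω) : delta x ≠ 0 := fun e => by
  have h := delta_apply_self x
  rw [e] at h
  simp at h

theorem delta_injective : Function.Injective (delta (Ω := Ω)) := fun x y e => by
  by_contra h
  have h1 := delta_apply_self x
  rw [e, delta_apply_of_ne h] at h1
  simp at h1

end Operators

/-! ### Zigzags -/

section Zigzags

theorem comp_eq_some {α : Type} {f g : α ≃. α} {x z : α} :
    comp f g x = some z ↔ ∃ y, g x = some y ∧ f y = some z :=
  PEquiv.trans_eq_some g f x z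

theorem comp_assoc {α : Type} (f g h : α ≃. α) : comp (comp f g) h = comp f (comp g h) :=
  (PEquiv.trans_assoc h g f).symm

theorem comp_symm {α : Type} (f g : α ≃. α) : (comp f g).symm = comp g.symm f.symm :=
  PEquiv.symm_trans_rev g f

theorem symm_comp_self_eq_some {α : Type} {f : α ≃. α} {x y : α} :
    comp f.symm f x = some y ↔ x = y ∧ ∃ z, f x = some z := by
  rw [comp_eq_some]
  constructor
  · rintro ⟨z, hz, hy⟩
    exact ⟨f.inj hz ((PEquiv.eq_some_iff f).1 hy), z, hz⟩
  · rintro ⟨rfl, z, hz⟩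
    exact ⟨z, hz, (PEquiv.eq_some_iff f).2 hz⟩

variable {C : Type}

/-- Concatenation of zigzags. -/
def Zigzag.append : Zigzag C → Zigzag C → Zigzag C
  | single a b, ξ => cons a b ξ
  | cons a b ζ, ξ => cons a b (ζ.append ξ)

/-- The zigzag read backwards. -/
def Zigzag.reverse : Zigzag C → Zigzag C
  | single a b => single b a
  | cons a b ζ => ζ.reverse.append (single b a)

section Word

variable {B : Type*} [NonUnitalCStarAlgebra B]

theorem Zigzag.word_append (v : C → B) (ζ ξ : Zigzag C) :
    (ζ.append ξ).word v = ζ.word v * ξ.word v := by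
  induction ζ with
  | single a b => rfl
  | cons a b ζ ih => simp [append, word, ih, mul_assoc]

end Word

variable [Monoid C] [IsLeftCancelMul C]

theorem tau_eq_some {a x y : C} : tau a x = some y ↔ a * x = y :=
  Option.some_inj

theorem sigma_eq_some {a x y : C} : sigma a x = some y ↔ a * y = x :=
  (PEquiv.eq_some_iff (tau a)).trans tau_eq_some

theorem Zigzag.map_append (ζ ξ : Zigzag C) : (ζ.append ξ).map = comp ζ.map ξ.map := by
  induction ζ with
  | single a b => rfl
  | cons a b ζ ih => simp [append, map, ih, comp_assoc]

theorem Zigzag.map_reverse (ζ : Zigzag C) : ζ.reverse.map = ζ.map.symm := by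
  induction ζ with
  | single a b => simp [reverse, map, comp_symm, sigma]
  | cons a b ζ ih => simp [reverse, map, map_append, comp_symm, ih, sigma]

theorem Zigzag.mem_pull (ζ : Zigzag C) (X : Set C) (x : C) :
    x ∈ ζ.pull X ↔ ∃ y ∈ X, ζ.map x = some y := by
  induction ζ generalizing X with
  | single a b =>
    simp [pull, map, leftDiv, leftMul, comp_eq_some, tau_eq_some, sigma_eq_some]
  | cons a b ζ ih =>
    simp only [pull, ih, map, leftDiv, leftMul, comp_eq_some, tau_eq_some, sigma_eq_some,
      Set.mem_ofPred_eq, Set.mem_image]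
    aesop

theorem Zigzag.mem_A (ζ : Zigzag C) (x : C) : x ∈ ζ.A ↔ ∃ y, ζ.map x = some y := by
  simp [A, mem_pull]

theorem Zigzag.mem_A_of_map {ζ : Zigzag C} {X : Set C}
    (h : ∀ x y, ζ.map x = some y ↔ x = y ∧ x ∈ X) : ζ.A = X := by
  ext x
  rw [mem_A]
  constructor
  · rintro ⟨y, hy⟩
    exact ((h x y).1 hy).2
  · intro hx
    exact ⟨x, (h x x).2 ⟨rfl, hx⟩⟩

/-- The zigzag `ζ* ζ`, whose map is the identity of `A(ζ)`. -/
def Zigzag.proj (ζ : Zigzag C) : Zigzag C := ζ.reverse.append ζ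

theorem Zigzag.map_proj (ζ : Zigzag C) (x y : C) :
    ζ.proj.map x = some y ↔ x = y ∧ x ∈ ζ.A := by
  rw [proj, map_append, map_reverse, symm_comp_self_eq_some, mem_A]

end Zigzags

/-! ### Implications between the relations -/

section Implications

variable {C : Type} [Monoid C] {B : Type*} [NonUnitalCStarAlgebra B]

/-- An idempotent partial isometry is a projection: expanding $(v-v^*v)^*(v-v^*v)$ for $v=v_1$ gives
$0$, hence $v=v^*v$. This lets $v_a$ and $v_a^*$ be read as the zigzag words of $(1,a)$ and $(a,1)$.
-/
theorem LiBase.eq_v_one {𝒥 : Set (Set C)} {v : C → B} {p : 𝒥 → B} (h : LiBase 𝒥 v p) :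
    star (v 1) = v 1 := by
  have hi : v 1 * v 1 = v 1 := by rw [h.L2, one_mul]
  have hi' : star (v 1) * star (v 1) = star (v 1) := by rw [← star_mul, hi]
  have key : star (v 1 - star (v 1) * v 1) * (v 1 - star (v 1) * v 1) = 0 := by
    have e1 : star (v 1) * (star (v 1) * v 1) = star (v 1) * v 1 := by rw [← mul_assoc, hi']
    have e2 : star (v 1) * v 1 * v 1 = star (v 1) * v 1 := by rw [mul_assoc, hi]
    have e3 : star (v 1) * v 1 * (star (v 1) * v 1) = star (v 1) * v 1 := by
      rw [mul_assoc, ← mul_assoc (v 1), h.partialIsometry]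
    rw [star_sub, star_mul, star_star, sub_mul, mul_sub, mul_sub, e1, e2, e3]
    simp
  rw [CStarRing.star_mul_self_eq_zero_iff, sub_eq_zero] at key
  rw [key]; simp

theorem LiBase.restrict {v : C → B} {p : JU C → B} (h : LiBase (JU C) v p) :
    LiBase (J C) v (fun X => p ⟨X.1, J_subset_JU C X.2⟩) where
  partialIsometry := h.partialIsometry
  projection _ := h.projection _
  L1 a _ hX := h.L1 a _ hX
  L2 := h.L2
  L3 _ hX := h.L3 _ hX

variable [IsLeftCancelMul C]

theorem L7.word_eq {𝒥 : Set (Set C)} {v : C → B} {p : 𝒥 → B} (h : L7 𝒥 v p) (ζ : Zigzag C)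
    (X : 𝒥) (hX : ∀ x y, ζ.map x = some y ↔ x = y ∧ x ∈ X.1) : ζ.word v = p X := by
  have hA := Zigzag.mem_A_of_map hX
  refine h ζ X hA.symm (PEquiv.ext fun x => Option.ext fun y => ?_)
  rw [PEquiv.ofSet_eq_some_iff, hX, hA]
  constructor
  · rintro ⟨rfl, h⟩; exact ⟨rfl, h⟩
  · rintro ⟨rfl, h⟩; exact ⟨rfl, h⟩

/-- By (L7), $p_{A(\zeta)}$ is the word of $\zeta^*\zeta$. A product of two such words is the word
of the concatenation, whose map is the identity of the intersection, so (L7) applies again. The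
empty set need not be some $A(\zeta)$ and is treated by (L3). -/
theorem L7.L4 {v : C → B} {p : J C → B} (hb : LiBase (J C) v p) (h : L7 (J C) v p) :
    L4 (J C) p := by
  intro X Y Z hZ
  by_cases hX : X.1 = ∅
  · rw [hb.L3 X hX, hb.L3 Z (by rw [hZ, hX, Set.empty_inter]), zero_mul]
  by_cases hY : Y.1 = ∅
  · rw [hb.L3 Y hY, hb.L3 Z (by rw [hZ, hY, Set.inter_empty]), mul_zero]
  obtain ⟨ζ, hζ⟩ := X.2.resolve_right hX
  obtain ⟨ξ, hξ⟩ := Y.2.resolve_right hY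
  rw [← h.word_eq ζ.proj X (by rw [← hζ]; exact ζ.map_proj),
    ← h.word_eq ξ.proj Y (by rw [← hξ]; exact ξ.map_proj), ← Zigzag.word_append]
  refine h.word_eq _ Z fun x y => ?_
  rw [Zigzag.map_append, comp_eq_some, hZ, ← hζ, ← hξ]
  simp only [Zigzag.map_proj, Set.mem_inter_iff]
  constructor
  · rintro ⟨_, ⟨rfl, h1⟩, rfl, h2⟩; exact ⟨rfl, h2, h1⟩
  · rintro ⟨rfl, h2, h1⟩; exact ⟨x, ⟨rfl, h1⟩, rfl, h2⟩

/-- The product $v_ap_Xv_a^*$ is the word of the zigzag $(1,a)\,\zeta^*\zeta\,(a,1)$, whose map is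
the identity of $aX$. -/
theorem L7.L5 {v : C → B} {p : J C → B} (hb : LiBase (J C) v p) (h : L7 (J C) v p) :
    L5 (J C) v p := by
  intro a X Y hY
  by_cases hX : X.1 = ∅
  · rw [hb.L3 X hX, hb.L3 Y (by rw [hY, hX, leftMul, Set.image_empty]), mul_zero, zero_mul]
  obtain ⟨ζ, hζ⟩ := X.2.resolve_right hX
  have h1 : v a = (Zigzag.single 1 a).word v := by
    rw [Zigzag.word, hb.eq_v_one, hb.L2, one_mul]
  have h2 : star (v a) = (Zigzag.single a 1).word v := by
    rw [Zigzag.word, ← hb.eq_v_one, ← star_mul, hb.L2, one_mul]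
  rw [← h.word_eq ζ.proj X (by rw [← hζ]; exact ζ.map_proj), h2, h1, ← Zigzag.word_append,
    ← Zigzag.word_append]
  refine h.word_eq _ Y fun x y => ?_
  rw [Zigzag.map_append, Zigzag.map_append, hY, ← hζ]
  simp only [comp_eq_some, Zigzag.map_proj, Zigzag.map, tau_eq_some, sigma_eq_some, leftMul,
    Set.mem_image, one_mul]
  constructor
  · rintro ⟨z, ⟨_, rfl, rfl⟩, _, ⟨rfl, hz⟩, _, rfl, rfl⟩
    exact ⟨rfl, z, hz, rfl⟩
  · rintro ⟨rfl, z, hz, rfl⟩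
    exact ⟨z, ⟨_, rfl, rfl⟩, _, ⟨rfl, hz⟩, _, rfl, rfl⟩

end Implications

/-! ### The canonical homomorphisms -/

section Canonical

variable (C : Type) [Monoid C]

/-- The inclusion of generators. -/
def inclGen (x : C ⊕ J C) : C ⊕ JU C := x.map id fun X => ⟨X.1, J_subset_JU C X.2⟩

theorem exists_isPiU : ∃ π : CLi C →⋆ₙₐ[ℂ] CLiU C, IsPiU π :=
  ⟨Universal.map (inclGen C) fun _ _ _ h =>
    ⟨h.1.restrict, fun _ _ _ hZ => h.2.1 _ _ _ hZ, fun _ _ _ hY => h.2.2.1 _ _ _ hY⟩,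
    fun _ => rfl, fun _ => rfl⟩

variable [IsLeftCancelMul C]

theorem exists_isRhoU : ∃ ρ : CLiS C →⋆ₙₐ[ℂ] CLiSU C, IsRhoU ρ :=
  ⟨Universal.map (inclGen C) fun _ _ _ h =>
    ⟨h.1.restrict, fun ζ _ hX hm => h.2.2 ζ _ hX hm⟩,
    fun _ => rfl, fun _ => rfl⟩

theorem exists_isQ : ∃ q : CZM C →⋆ₙₐ[ℂ] Toeplitz C, IsQ q :=
  ⟨Universal.map id fun _ _ _ h => h.1, fun _ => rfl⟩

theorem exists_isPiS : ∃ π : CLi C →⋆ₙₐ[ℂ] CLiS C, IsPiS π :=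
  ⟨Universal.map id fun _ _ _ h => ⟨h.1, L7.L4 h.1 h.2, L7.L5 h.1 h.2⟩, fun _ => rfl⟩

end Canonical

/-! ### Representations by partial bijections -/

section Representations

open Classical in
/-- The identity of the subset `X`. -/
def idOn {Ω : Type} (X : Set Ω) : Ω ≃. Ω := PEquiv.ofSet X

theorem idOn_eq_some {Ω : Type} {X : Set Ω} {x y : Ω} : idOn X x = some y ↔ x = y ∧ x ∈ X := by
  classical
  rw [idOn, PEquiv.ofSet_eq_some_iff]
  constructor
  · rintro ⟨rfl, h⟩; exact ⟨rfl, h⟩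
  · rintro ⟨rfl, h⟩; exact ⟨rfl, h⟩

theorem isStarProjection_shift_idOn {Ω : Type} (X : Set Ω) :
    IsStarProjection (shift (idOn X)) where
  isIdempotentElem := by
    rw [IsIdempotentElem, ← shift_trans]
    congr 1
    ext x y
    simp only [PEquiv.trans_eq_some, idOn_eq_some]
    aesop
  isSelfAdjoint := by
    rw [IsSelfAdjoint, ← shift_symm, idOn, PEquiv.ofSet_symm]

theorem shift_idOn_mul {Ω : Type} (X Y : Set Ω) :
    shift (idOn X) * shift (idOn Y) = shift (idOn (X ∩ Y)) := by
  rw [← shift_trans]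
  congr 1
  ext x y
  simp only [PEquiv.trans_eq_some, idOn_eq_some, Set.mem_inter_iff]
  aesop

theorem idOn_empty {Ω : Type} : idOn (∅ : Set Ω) = ⊥ := by
  ext x y
  simp [idOn_eq_some]

theorem shift_mul_star_mul {Ω : Type} (f : Ω ≃. Ω) :
    shift f * star (shift f) * shift f = shift f := by
  rw [← shift_symm, ← shift_trans, ← shift_trans]
  congr 1
  ext x y
  simp only [PEquiv.trans_eq_some, PEquiv.eq_some_iff]
  constructor
  · rintro ⟨z, hz, w, hw, hy⟩
    rwa [f.inj hw hz] at hy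
  · exact fun h => ⟨y, h, x, h, h⟩

theorem star_shift_mul_self {Ω : Type} (f : Ω ≃. Ω) :
    star (shift f) * shift f = shift (idOn {x | ∃ y, f x = some y}) := by
  rw [← shift_symm, ← shift_trans]
  congr 1
  ext x y
  simp only [PEquiv.trans_eq_some, PEquiv.eq_some_iff, idOn_eq_some,
    Set.mem_ofPred_eq]
  constructor
  · rintro ⟨z, hz, hw⟩
    exact ⟨f.inj hz hw, z, hz⟩
  · rintro ⟨rfl, z, hz⟩
    exact ⟨z, hz, hz⟩

theorem shift_idOn_delta_of_mem {Ω : Type} {X : Set Ω} {x : Ω} (h : x ∈ X) :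
    shift (idOn X) (delta x) = delta x :=
  shift_delta_of_eq_some (idOn_eq_some.2 ⟨rfl, h⟩)

theorem shift_idOn_delta_of_notMem {Ω : Type} {X : Set Ω} {x : Ω} (h : x ∉ X) :
    shift (idOn X) (delta x) = 0 :=
  shift_delta_of_eq_none (Option.eq_none_iff_forall_ne_some.2 fun _ h' =>
    h (idOn_eq_some.1 h').2)

/-! ### Actions by partial bijections, and the diagonal action on pairs. -/

variable {C : Type} {Ω : Type}

theorem liBase_shift [Monoid C] (𝒥 : Set (Set C)) {T : C → Ω ≃. Ω} {P : Set C → Set Ω}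
    (hmul : ∀ a b, (T b).trans (T a) = T (a * b)) (htot : ∀ a x, ∃ y, T a x = some y)
    (huniv : P Set.univ = Set.univ) (hempty : P ∅ = ∅) :
    LiBase 𝒥 (fun a => shift (T a)) (fun X => shift (idOn (P X.1))) where
  partialIsometry _ := shift_mul_star_mul _
  projection _ := isStarProjection_shift_idOn _
  L1 a X hX := by
    rw [star_shift_mul_self, hX, huniv]
    congr 2
    exact Set.eq_univ_of_forall (htot a)
  L2 a b := by rw [← shift_trans, hmul]
  L3 X hX := by rw [hX, hempty, idOn_empty, shift_bot]

/-- The componentwise action of a partial bijection on pairs. -/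
def square (f : C ≃. C) : C × C ≃. C × C where
  toFun p := (f p.1).bind fun x => (f p.2).bind fun y => some (x, y)
  invFun p := (f.symm p.1).bind fun x => (f.symm p.2).bind fun y => some (x, y)
  inv := by
    rintro ⟨x, y⟩ ⟨z, w⟩
    simp [Option.bind_eq_some_iff, PEquiv.eq_some_iff]

theorem square_eq_some {f : C ≃. C} {p q : C × C} :
    square f p = some q ↔ f p.1 = some q.1 ∧ f p.2 = some q.2 := by
  obtain ⟨x, y⟩ := p
  obtain ⟨z, w⟩ := q
  change ((f x).bind fun x => (f y).bind fun y => some (x, y)) = some (z, w) ↔ _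
  simp [Option.bind_eq_some_iff]

theorem square_symm (f : C ≃. C) : square f.symm = (square f).symm := rfl

theorem square_comp (f g : C ≃. C) : square (comp f g) = (square g).trans (square f) := by
  ext p q
  simp only [square_eq_some, comp_eq_some, PEquiv.trans_eq_some, Prod.exists]
  aesop

theorem square_idOn (X : Set C) : square (idOn X) = idOn (X ×ˢ X) := by
  ext ⟨x, y⟩ ⟨z, w⟩
  simp only [square_eq_some, idOn_eq_some, Set.mem_prod, Prod.mk.injEq]
  tauto

theorem square_bot : square (⊥ : C ≃. C) = ⊥ := by
  ext p q
  simp [square_eq_some]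

variable [Monoid C] [IsLeftCancelMul C]

theorem isZMRep_square : IsZMRep fun s : ZM C => shift (square s.1) where
  mul s t := by
    change shift (square (comp s.1 t.1)) = _
    rw [square_comp, shift_trans]
  star s := by
    change shift (square s.1.symm) = _
    rw [square_symm, shift_symm]
  zero := by
    change shift (square ⊥) = 0
    rw [square_bot, shift_bot]

theorem liBase_square (𝒥 : Set (Set C)) :
    LiBase 𝒥 (fun a => shift (square (tau a))) (fun X => shift (idOn (X.1 ×ˢ X.1))) := by
  refine liBase_shift 𝒥 (T := fun a => square (tau a)) (P := fun X => X ×ˢ X) ?_ ?_ (by simp)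
    (by simp)
  · intro a b
    rw [← square_comp]
    congr 1
    ext x y
    simp only [comp_eq_some, tau_eq_some]
    simp [mul_assoc]
  · intro a p
    exact ⟨(a * p.1, a * p.2), square_eq_some.2 ⟨tau_eq_some.2 rfl, tau_eq_some.2 rfl⟩⟩

theorem word_square (ζ : Zigzag C) :
    ζ.word (fun a => shift (square (tau a))) = shift (square ζ.map) := by
  induction ζ with
  | single a b =>
    rw [Zigzag.word, Zigzag.map, square_comp, shift_trans, sigma, square_symm, shift_symm]
  | cons a b ζ ih =>
    rw [Zigzag.word, Zigzag.map, square_comp, shift_trans, square_comp, shift_trans, sigma,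
      square_symm, shift_symm, ih]

theorem L7_square (𝒥 : Set (Set C)) :
    L7 𝒥 (fun a => shift (square (tau a))) (fun X => shift (idOn (X.1 ×ˢ X.1))) := by
  intro ζ X hX hζ
  rw [word_square, hζ]
  change _ = shift (idOn (X.1 ×ˢ X.1))
  rw [hX, ← square_idOn]
  rfl

end Representations

/-! ### Failure of independence -/

section Independence

/-- In `ℓ²(C × C)` the projection of `X × X` is not the join of those of `Y × Y` and `Z × Z` if
`X` contains a point outside of `Y` and a point outside of `Z`. -/
theorem shift_idOn_prod_ne {C : Type} {X Y Z : Set C} {c d : C} (hc : c ∈ X) (hd : d ∈ X) (hdY : d ∉ Y)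
    (hcZ : c ∉ Z) :
    shift (idOn (X ×ˢ X)) ≠ shift (idOn (Y ×ˢ Y)) + shift (idOn (Z ×ˢ Z)) -
      shift (idOn (Y ×ˢ Y)) * shift (idOn (Z ×ˢ Z)) := by
  intro h
  have h1 := DFunLike.congr_fun h (delta (c, d))
  have hX : (c, d) ∈ X ×ˢ X := ⟨hc, hd⟩
  rw [shift_idOn_delta_of_mem hX, sub_apply,
    add_apply, ContinuousLinearMap.mul_def, ContinuousLinearMap.comp_apply,
    shift_idOn_delta_of_notMem fun h => hdY h.2,
    shift_idOn_delta_of_notMem fun h => hcZ h.1] at h1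
  exact delta_ne_zero (c, d) (by simpa using h1)

variable {C : Type} [Monoid C] [IsLeftCancelMul C]

variable (C) in
/-- The representation of `C*_{Li,s}(C)` on `ℓ²(C × C)`. -/
def squareModel : Model (liSRel C) where
  carrier := EllTwo (C × C) →L[ℂ] EllTwo (C × C)
  family := Sum.elim (fun a => shift (square (tau a))) (fun X => shift (idOn (X.1 ×ˢ X.1)))
  holds := ⟨liBase_square _, L7_square _⟩

variable (C) in
/-- The representation of `C*_Li(C)` on `ℓ²(C × C)`. -/
def squareModelLi : Model (liRel C) where
  carrier := EllTwo (C × C) →L[ℂ] EllTwo (C × C)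
  family := (squareModel C).family
  holds := ⟨(squareModel C).holds.1, L7.L4 (squareModel C).holds.1 (squareModel C).holds.2,
    L7.L5 (squareModel C).holds.1 (squareModel C).holds.2⟩

variable (C) in
/-- The representation of `C*(ZM(C))` on `ℓ²(C × C)`. -/
def squareModelZM : Model (zmRel C) where
  carrier := EllTwo (C × C) →L[ℂ] EllTwo (C × C)
  family := fun s => shift (square s.1)
  holds := isZMRep_square

theorem Zigzag.inZM (ζ : Zigzag C) : InZM ζ.map := by
  induction ζ with
  | single a b => exact (InZM.sigma a).comp (InZM.tau b)
  | cons a b ζ ih => exact ((InZM.sigma a).comp (InZM.tau b)).comp ih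

/-- The constructible right ideal `A(ζ)` as an element of `𝒥(C)`. -/
def Zigzag.ideal (ζ : Zigzag C) : J C := ⟨ζ.A, Or.inl ⟨ζ, rfl⟩⟩

variable {ζ ξ η : Zigzag C} {c d : C}

/-- The projection of `ζ.A` and the join of the other two have equal images by (L6), but the
representation on $\ell^2(C\times C)$ separates them at $\delta_{(c,d)}$. -/
theorem not_injective_of_isPiU (hA : ζ.A = ξ.A ∪ η.A) (hc : c ∈ ξ.A) (hd : d ∈ η.A)
    (hdξ : d ∉ ξ.A) (hcη : c ∉ η.A) {π : CLi C →⋆ₙₐ[ℂ] CLiU C} (hπ : IsPiU π) :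
    ¬ Function.Injective π := by
  intro hinj
  let g : Zigzag C → CLi C := fun ζ => .gen _ (.inr ζ.ideal)
  have h : g ζ = g ξ + g η - g ξ * g η := by
    apply hinj
    rw [map_sub, map_add, map_mul, hπ.2, hπ.2, hπ.2]
    exact Universal.ext_model fun M => M.holds.2.2.2 _ _ _ hA
  have hcA : c ∈ ζ.A := hA ▸ Or.inl hc
  have hdA : d ∈ ζ.A := hA ▸ Or.inr hd
  exact shift_idOn_prod_ne hcA hdA hdξ hcη
    (congrArg (Universal.toModel (squareModelLi C)) h)

theorem not_injective_of_isRhoU (hA : ζ.A = ξ.A ∪ η.A) (hc : c ∈ ξ.A) (hd : d ∈ η.A)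
    (hdξ : d ∉ ξ.A) (hcη : c ∉ η.A) {ρ : CLiS C →⋆ₙₐ[ℂ] CLiSU C} (hρ : IsRhoU ρ) :
    ¬ Function.Injective ρ := by
  intro hinj
  let g : Zigzag C → CLiS C := fun ζ => .gen _ (.inr ζ.ideal)
  have h : g ζ = g ξ + g η - g ξ * g η := by
    apply hinj
    rw [map_sub, map_add, map_mul, hρ.2, hρ.2, hρ.2]
    exact Universal.ext_model fun M => M.holds.2.1 _ _ _ hA
  have hcA : c ∈ ζ.A := hA ▸ Or.inl hc
  have hdA : d ∈ ζ.A := hA ▸ Or.inr hd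
  exact shift_idOn_prod_ne hcA hdA hdξ hcη
    (congrArg (Universal.toModel (squareModel C)) h)

theorem not_injective_of_isQ (hA : ζ.A = ξ.A ∪ η.A) (hc : c ∈ ξ.A) (hd : d ∈ η.A)
    (hdξ : d ∉ ξ.A) (hcη : c ∉ η.A) {q : CZM C →⋆ₙₐ[ℂ] Toeplitz C} (hq : IsQ q) :
    ¬ Function.Injective q := by
  intro hinj
  let s : Zigzag C → ZM C := fun ζ => ⟨ζ.map, ζ.inZM⟩
  let g : Zigzag C → CZM C := fun ζ => .gen _ (star (s ζ) * s ζ)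
  have hdom : ∀ (ζ : Zigzag C) (x : C), x ∈ (s ζ).dom ↔ x ∈ ζ.A := fun ζ x => by
    rw [Zigzag.mem_A]
    exact Option.isSome_iff_exists
  have h : g ζ = g ξ + g η - g ξ * g η := by
    apply hinj
    rw [map_sub, map_add, map_mul, hq, hq, hq]
    refine Universal.ext_model fun M => ?_
    -- Join preservation takes the place of (L6) here: the domains of `s ξ` and `s η` cover that of
    -- `s ζ`.
    have := M.holds.2 (s ζ) [s ξ, s η] fun x => by simp [hdom, hA]
    simp only [List.map_cons, List.map_nil, projJoin, mul_zero, add_zero, sub_zero] at this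
    exact this
  have hg : ∀ ζ : Zigzag C, Universal.toModel (squareModelZM C) (g ζ) =
      shift (idOn (ζ.A ×ˢ ζ.A)) := fun ζ => by
    change shift (square (comp ζ.map.symm ζ.map)) = _
    rw [← square_idOn]
    congr 2
    ext x y
    rw [symm_comp_self_eq_some, idOn_eq_some, Zigzag.mem_A]
  have h' := congrArg (Universal.toModel (squareModelZM C)) h
  rw [map_sub, map_add, map_mul, hg, hg, hg] at h'
  have hcA : c ∈ ζ.A := hA ▸ Or.inl hc
  have hdA : d ∈ ζ.A := hA ▸ Or.inr hd
  exact shift_idOn_prod_ne hcA hdA hdξ hcη h'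

end Independence

/-! ### Failure of (L7) -/

section Injections

variable {Ω : Type}

/-- The partial bijection onto its image given by an injective map. -/
def ofInjective (f : Ω → Ω) (hf : Function.Injective f) : Ω ≃. Ω where
  toFun x := some (f x)
  invFun := Function.partialInv f
  inv x y := (hf.isPartialInv x y).trans Option.some_inj.symm

theorem ofInjective_eq_some {f : Ω → Ω} {hf : Function.Injective f} {x y : Ω} :
    ofInjective f hf x = some y ↔ f x = y := Option.some_inj

theorem shift_mul_idOn_mul_star {f : Ω → Ω} (hf : Function.Injective f) (X : Set Ω) :
    shift (ofInjective f hf) * shift (idOn X) * star (shift (ofInjective f hf)) =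
      shift (idOn (f '' X)) := by
  rw [← shift_symm, ← shift_trans, ← shift_trans]
  congr 1
  ext x y
  simp only [PEquiv.trans_eq_some, PEquiv.eq_some_iff, ofInjective_eq_some, idOn_eq_some,
    Set.mem_image]
  aesop

theorem shift_ofInjective_delta {f : Ω → Ω} (hf : Function.Injective f) (x : Ω) :
    shift (ofInjective f hf) (delta x) = delta (f x) :=
  shift_delta_of_eq_some rfl

theorem star_shift_ofInjective_delta {f : Ω → Ω} (hf : Function.Injective f) (x : Ω) :
    star (shift (ofInjective f hf)) (delta (f x)) = delta x := by
  rw [← shift_symm]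
  exact shift_delta_of_eq_some ((PEquiv.eq_some_iff _).2 rfl)

end Injections

section Twist

variable {C : Type} [Monoid C]

open Classical in
/-- The diagonal left multiplication on `C × C`, lifted to a double cover with monodromy at the
point `p₀`: the sheets are exchanged by `a ∈ S` at `p₀`. -/
def twist (S : Set C) (p₀ : C × C) (a : C) (ω : (C × C) × Bool) : (C × C) × Bool :=
  ((a * ω.1.1, a * ω.1.2), ω.2 ^^ decide (ω.1 = p₀ ∧ a ∈ S))

variable {S : Set C} {p₀ : C × C}

theorem twist_injective [IsLeftCancelMul C] (a : C) : Function.Injective (twist S p₀ a) := by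
  rintro ⟨⟨x, y⟩, t⟩ ⟨⟨x', y'⟩, t'⟩ h
  simp only [twist, Prod.mk.injEq] at h
  obtain ⟨⟨h1, h2⟩, h3⟩ := h
  obtain rfl := mul_left_cancel h1
  obtain rfl := mul_left_cancel h2
  simpa using h3

/-- This is the cocycle identity for the sheet exchange. If $b\ne1$, then by `hmin` the point
reached after $b$ is never $p_0$, so $a$ exchanges nothing; the total exchange at $p_0$ is decided
by $b\in S$, which is $ab\in S$ by `hS`. If $b=1$, then $b$ exchanges nothing since $1\notin S$. -/
theorem twist_twist (h1 : 1 ∉ S) (hS : ∀ a b, b ≠ 1 → (a * b ∈ S ↔ b ∈ S))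
    (hmin : ∀ b x y, b * x = p₀.1 → b * y = p₀.2 → b = 1) (a b : C) (ω : (C × C) × Bool) :
    twist S p₀ a (twist S p₀ b ω) = twist S p₀ (a * b) ω := by
  obtain ⟨⟨x, y⟩, t⟩ := ω
  by_cases hb : b = 1
  · subst hb
    simp only [twist, h1, and_false, decide_false, Bool.xor_false, one_mul, mul_one]
    refine congrArg (fun s => ((a * x, a * y), t ^^ s)) (decide_eq_decide.2 ?_)
    rw [one_mul, one_mul, mul_one]
  · have hp : (b * x, b * y) ≠ p₀ := fun e => hb (hmin b x y (by rw [← e]) (by rw [← e]))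
    simp [twist, hp, mul_assoc, hS a b hb]

theorem twist_of_ne {a x y : C} (t : Bool) (h : (x, y) ≠ p₀) :
    twist S p₀ a ((x, y), t) = ((a * x, a * y), t) := by
  simp [twist, h]

theorem twist_of_notMem {a x y : C} (t : Bool) (h : a ∉ S) :
    twist S p₀ a ((x, y), t) = ((a * x, a * y), t) := by
  simp [twist, h]

theorem twist_of_mem {a x y : C} (t : Bool) (h : a ∈ S) :
    twist S (x, y) a ((x, y), t) = ((a * x, a * y), !t) := by
  simp [twist, h]

variable [IsLeftCancelMul C]

/-- The representation of `C*_Li(C)` on `ℓ²(C × C × {0, 1})` given by a twisted action. -/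
def twistModel (h1 : 1 ∉ S) (hS : ∀ a b, b ≠ 1 → (a * b ∈ S ↔ b ∈ S))
    (hmin : ∀ b x y, b * x = p₀.1 → b * y = p₀.2 → b = 1) : Model (liRel C) where
  carrier := EllTwo ((C × C) × Bool) →L[ℂ] EllTwo ((C × C) × Bool)
  family := Sum.elim (fun a => shift (ofInjective (twist S p₀ a) (twist_injective a)))
    (fun X => shift (idOn ((X.1 ×ˢ X.1) ×ˢ Set.univ)))
  holds := by
    refine ⟨liBase_shift _ (T := fun a => ofInjective (twist S p₀ a) (twist_injective a))
      (P := fun X => (X ×ˢ X) ×ˢ Set.univ) ?_ (fun a x => ⟨_, rfl⟩) (by simp) (by simp), ?_, ?_⟩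
    · intro a b
      ext x y
      simp [PEquiv.trans_eq_some, ofInjective_eq_some, twist_twist h1 hS hmin]
    · intro X Y Z hZ
      change shift (idOn ((X.1 ×ˢ X.1) ×ˢ Set.univ)) * shift (idOn ((Y.1 ×ˢ Y.1) ×ˢ Set.univ)) =
        shift (idOn ((Z.1 ×ˢ Z.1) ×ˢ Set.univ))
      rw [shift_idOn_mul, hZ]
      congr 2
      ext ⟨⟨x, y⟩, t⟩
      simp only [Set.mem_inter_iff, Set.mem_prod, Set.mem_univ, and_true]
      tauto
    · intro a X Y hY
      change shift (ofInjective _ _) * shift (idOn ((X.1 ×ˢ X.1) ×ˢ Set.univ)) *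
        star (shift (ofInjective _ _)) = shift (idOn ((Y.1 ×ˢ Y.1) ×ˢ Set.univ))
      rw [shift_mul_idOn_mul_star, hY]
      congr 2
      ext ⟨⟨x, y⟩, t⟩
      simp only [Set.mem_image, Set.mem_prod, Set.mem_univ, and_true, leftMul]
      constructor
      · rintro ⟨⟨⟨z, w⟩, u⟩, ⟨hz, hw⟩, h⟩
        simp only [twist, Prod.mk.injEq] at h
        exact ⟨⟨z, hz, h.1.1⟩, w, hw, h.1.2⟩
      · rintro ⟨⟨z, hz, rfl⟩, w, hw, rfl⟩
        classical
        -- The starting sheet is chosen so that the exchange by `a`, if any, ends on sheet `t`.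
        refine ⟨((z, w), t ^^ decide ((z, w) = p₀ ∧ a ∈ S)), ⟨hz, hw⟩, ?_⟩
        simp [twist]

/-- The zigzag $(b_2,a_2,a_1,b_1)$ fixes every point of its domain by `hmap`, so (L7) makes its word
a projection. In the twisted representation the loop from $(c,d)$ passes through $(c',d')$ and meets
exactly one exchange, on applying $a_2\in S$; it therefore moves a basis vector to the other sheet.
-/
theorem not_injective_of_isPiS {a₁ b₁ a₂ b₂ c d c' d' : C} (h1 : 1 ∉ S)
    (hS : ∀ a b, b ≠ 1 → (a * b ∈ S ↔ b ∈ S))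
    (hmin : ∀ b x y, b * x = c' → b * y = d' → b = 1) (ha₁ : a₁ ∉ S) (ha₂ : a₂ ∈ S)
    (hne : (c, d) ≠ (c', d')) (hc : b₁ * c = a₁ * c') (hd : b₁ * d = a₁ * d')
    (hmap : ∀ x y, b₁ * x = a₁ * y → b₂ * x = a₂ * y)
    {π : CLi C →⋆ₙₐ[ℂ] CLiS C} (hπ : IsPiS π) : ¬ Function.Injective π := by
  classical
  intro hinj
  let ζ : Zigzag C := .cons b₂ a₂ (.single a₁ b₁)
  let v : C → CLi C := fun a => .gen _ (.inl a)
  have hζ : ∀ x y, ζ.map x = some y ↔ x = y ∧ x ∈ ζ.A := by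
    have key : ∀ x y, ζ.map x = some y → x = y := fun x y h => by
      simp only [ζ, Zigzag.map, comp_eq_some, tau_eq_some, sigma_eq_some] at h
      obtain ⟨z, ⟨_, rfl, hz⟩, _, rfl, hy⟩ := h
      exact mul_left_cancel ((hmap x z hz.symm).trans hy.symm)
    intro x y
    rw [Zigzag.mem_A]
    constructor
    · intro h
      exact ⟨key x y h, y, h⟩
    · rintro ⟨rfl, z, hz⟩
      rwa [← key x z hz] at hz
  have h : star (v b₂) * v a₂ * (star (v a₁) * v b₁) = .gen _ (.inr ζ.ideal) := by
    apply hinj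
    simp only [map_mul, map_star, v, hπ _]
    exact Universal.ext_model fun M => M.holds.2.word_eq ζ ζ.ideal hζ
  let V : C → EllTwo ((C × C) × Bool) →L[ℂ] EllTwo ((C × C) × Bool) := fun a =>
    shift (ofInjective (twist S (c', d') a) (twist_injective a))
  have h' : star (V b₂) * V a₂ * (star (V a₁) * V b₁) =
      shift (idOn ((ζ.A ×ˢ ζ.A) ×ˢ Set.univ)) :=
    congrArg (Universal.toModel (twistModel (p₀ := (c', d')) h1 hS hmin)) h
  have e1 : twist S (c', d') b₁ ((c, d), false) = twist S (c', d') a₁ ((c', d'), false) := by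
    rw [twist_of_ne _ hne, twist_of_notMem _ ha₁, hc, hd]
  have e2 : twist S (c', d') a₂ ((c', d'), false) = twist S (c', d') b₂ ((c, d), true) := by
    rw [twist_of_ne _ hne, twist_of_mem _ ha₂, hmap _ _ hc, hmap _ _ hd, Bool.not_false]
  have hA : ∀ x y, b₁ * x = a₁ * y → x ∈ ζ.A := fun x y h => by
    rw [Zigzag.mem_A]
    refine ⟨x, ?_⟩
    simp only [ζ, Zigzag.map, comp_eq_some, tau_eq_some, sigma_eq_some]
    exact ⟨y, ⟨_, rfl, h.symm⟩, _, rfl, hmap x y h⟩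
  have h3 := DFunLike.congr_fun h' (delta ((c, d), false))
  have hmem : ((c, d), false) ∈ (ζ.A ×ˢ ζ.A) ×ˢ (Set.univ : Set Bool) :=
    ⟨⟨hA c c' hc, hA d d' hd⟩, trivial⟩
  simp only [ContinuousLinearMap.mul_def, ContinuousLinearMap.comp_apply, V, shift_ofInjective_delta] at h3
  rw [e1, star_shift_ofInjective_delta, shift_ofInjective_delta, e2,
    star_shift_ofInjective_delta, shift_idOn_delta_of_mem hmem] at h3
  exact absurd (delta_injective h3) (by simp)

end Twist

/-! ### The monoid -/

namespace Example

/-- States of the automaton that reads positive words in the letters `h = 0`, `α₁ = 1`, `α₂ = 2`,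
`c = 3`, `d = 4` from left to right: after `α₁` or `α₂` one letter `h` is allowed (`credit`), and
any other `h` has to be followed by `c` or `d` (`debt`). -/
inductive State
  | neutral
  | credit
  | debt

open State

/-- The transitions of the automaton. -/
def step : State → Fin 5 → Option State
  | neutral, 0 => some debt
  | neutral, 1 => some credit
  | neutral, 2 => some credit
  | neutral, 3 => some neutral
  | neutral, 4 => some neutral
  | credit, 0 => some neutral
  | credit, 1 => some credit
  | credit, 2 => some credit
  | credit, 3 => some neutral
  | credit, 4 => some neutral
  | debt, 0 => none
  | debt, 1 => none
  | debt, 2 => none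
  | debt, 3 => some neutral
  | debt, 4 => some neutral

/-- The words accepted from a given state. -/
def Accepts : State → List (Fin 5) → Prop
  | s, [] => s ≠ debt
  | s, x :: w => ∃ s', step s x = some s' ∧ Accepts s' w

/-! ### Concatenation and quotients of accepted words. -/

theorem accepts_neutral_of_debt {w : List (Fin 5)} (h : Accepts debt w) : Accepts neutral w := by
  cases w with
  | nil => exact absurd rfl h
  | cons x w => fin_cases x <;> simp_all [Accepts, step]

theorem accepts_credit_of_neutral {w : List (Fin 5)} (h : Accepts neutral w) :
    Accepts credit w := by
  cases w with
  | nil => simp [Accepts]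
  | cons x w =>
    fin_cases x <;> simp_all [Accepts, step]
    exact accepts_neutral_of_debt h

/-- An accepted word ends in `neutral` or `credit`, and `credit` accepts whatever `neutral` does. -/
theorem accepts_append {s : State} {u w : List (Fin 5)} (hu : Accepts s u)
    (hw : Accepts neutral w) : Accepts s (u ++ w) := by
  induction u generalizing s with
  | nil =>
    cases s with
    | neutral => exact hw
    | credit => exact accepts_credit_of_neutral hw
    | debt => exact absurd rfl hu
  | cons x u ih =>
    obtain ⟨s', h1, h2⟩ := hu
    exact ⟨s', h1, ih h2⟩

theorem accepts_credit_of_append {s : State} {u w : List (Fin 5)} (hu : Accepts s u)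
    (h : Accepts s (u ++ w)) : Accepts credit w := by
  induction u generalizing s with
  | nil =>
    cases s with
    | neutral => exact accepts_credit_of_neutral h
    | credit => exact h
    | debt => exact absurd rfl hu
  | cons x u ih =>
    obtain ⟨s', h1, h2⟩ := hu
    obtain ⟨s'', h3, h4⟩ := h
    rw [h1] at h3
    cases h3
    exact ih h2 h4

theorem accepts_zero_cons {w : List (Fin 5)} :
    Accepts neutral (0 :: w) ↔ ∃ u, Accepts neutral u ∧ (w = 3 :: u ∨ w = 4 :: u) := by
  cases w with
  | nil => simp [Accepts, step]
  | cons x w => fin_cases x <;> simp [Accepts, step]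

/-- The states `credit` and `neutral` differ only on a first letter $h$. After it, `neutral` demands
$c$ or $d$: either this letter comes next, or the word stops at $h$, or another letter makes every
continuation fail. This trichotomy drives finite alignment. -/
theorem accepts_credit_cases {u : List (Fin 5)} (h : Accepts credit u) :
    Accepts neutral u ∨ u = [0] ∨ ∀ w, ¬ Accepts neutral (u ++ w) := by
  cases u with
  | nil => left; simp [Accepts]
  | cons x u =>
    fin_cases x <;> simp_all [Accepts, step]
    cases u with
    | nil => simp
    | cons y u => fin_cases y <;> simp_all [Accepts, step]

/-- The element of the free group given by a positive word. -/
def pos (w : List (Fin 5)) : FreeGroup (Fin 5) := FreeGroup.mk (w.map fun x => (x, true))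

theorem pos_append (u w : List (Fin 5)) : pos (u ++ w) = pos u * pos w := by
  simp [pos, FreeGroup.mul_mk]

/-- A positive word contains no inverse letters, so nothing cancels. -/
theorem toWord_pos (w : List (Fin 5)) : (pos w).toWord = w.map fun x => (x, true) := by
  rw [pos, FreeGroup.toWord_mk]
  refine FreeGroup.IsReduced.reduce_eq ?_
  rw [FreeGroup.IsReduced, List.isChain_map]
  induction w with
  | nil => simp
  | cons x w ih => cases w <;> simp_all

theorem pos_injective : Function.Injective pos := fun u w h => by
  have h' := congrArg FreeGroup.toWord h
  rw [toWord_pos, toWord_pos] at h'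
  exact List.map_injective_iff.2 (fun x y e => (Prod.mk.inj e).1) h'

/-- The submonoid of the accepted positive words in the free group. It is generated by `αᵢ`, `αᵢh`,
`c`, `d`, `hc` and `hd`. -/
def monoid : Submonoid (FreeGroup (Fin 5)) where
  carrier := {g | ∃ w, Accepts neutral w ∧ pos w = g}
  one_mem' := ⟨[], by simp [Accepts], rfl⟩
  mul_mem' := by
    rintro _ _ ⟨u, hu, rfl⟩ ⟨w, hw, rfl⟩
    exact ⟨u ++ w, accepts_append hu hw, pos_append u w⟩

/-- The positive word of an element. -/
def word (a : monoid) : List (Fin 5) := a.2.choose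

theorem accepts_word (a : monoid) : Accepts neutral (word a) := a.2.choose_spec.1

theorem pos_word (a : monoid) : pos (word a) = a.1 := a.2.choose_spec.2

theorem word_injective : Function.Injective word := fun a b h =>
  Subtype.ext (by rw [← pos_word, ← pos_word, h])

theorem word_mul (a b : monoid) : word (a * b) = word a ++ word b :=
  pos_injective (by rw [pos_append, pos_word, pos_word, pos_word]; rfl)

theorem word_one : word 1 = [] := pos_injective (by rw [pos_word]; rfl)

/-- The element given by an accepted word. -/
def ofWord (w : List (Fin 5)) (h : Accepts neutral w) : monoid := ⟨pos w, w, h, rfl⟩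

theorem word_ofWord {w : List (Fin 5)} (h : Accepts neutral w) : word (ofWord w h) = w :=
  pos_injective (pos_word _)

theorem exists_mul_eq {a z : monoid} :
    (∃ x, a * x = z) ↔ ∃ u, Accepts neutral u ∧ word z = word a ++ u := by
  constructor
  · rintro ⟨x, rfl⟩
    exact ⟨word x, accepts_word x, word_mul a x⟩
  · rintro ⟨u, hu, h⟩
    exact ⟨ofWord u hu, word_injective (by rw [word_mul, word_ofWord, h])⟩

theorem hasNoInverses : HasNoInverses monoid := fun a b h => by
  have h' := congrArg word h
  rw [word_mul, word_one, List.append_eq_nil_iff] at h'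
  exact ⟨word_injective (h'.1.trans word_one.symm), word_injective (h'.2.trans word_one.symm)⟩

/-- `c` -/
def c : monoid := ofWord [3] (by simp [Accepts, step])

/-- `d` -/
def d : monoid := ofWord [4] (by simp [Accepts, step])

/-- `hc` -/
def hc : monoid := ofWord [0, 3] (by simp [Accepts, step])

/-- `hd` -/
def hd : monoid := ofWord [0, 4] (by simp [Accepts, step])

/-- `α₁` -/
def α₁ : monoid := ofWord [1] (by simp [Accepts, step])

/-- `α₂` -/
def α₂ : monoid := ofWord [2] (by simp [Accepts, step])

/-- `α₁h` -/
def α₁h : monoid := ofWord [1, 0] (by simp [Accepts, step])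

/-- `α₂h` -/
def α₂h : monoid := ofWord [2, 0] (by simp [Accepts, step])

theorem word_c : word c = [3] := word_ofWord _

theorem word_d : word d = [4] := word_ofWord _

theorem word_hc : word hc = [0, 3] := word_ofWord _

theorem word_hd : word hd = [0, 4] := word_ofWord _

theorem word_α₁ : word α₁ = [1] := word_ofWord _

theorem word_α₂ : word α₂ = [2] := word_ofWord _

theorem word_α₁h : word α₁h = [1, 0] := word_ofWord _

theorem word_α₂h : word α₂h = [2, 0] := word_ofWord _

/-- With $b=au$ in the free group, $aC\cap bC$ consists of the $bx$ with $x\in C$ and $ux\in C$. By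
the trichotomy for $u$ it is $bC$ if $u\in C$, $bcC\cup bdC$ if $u=h$, and empty otherwise. -/
theorem range_inter_of_prefix {a b : monoid} {u : List (Fin 5)} (h : word b = word a ++ u) :
    ∃ F : Finset monoid,
      Set.range (a * ·) ∩ Set.range (b * ·) = ⋃ z ∈ F, Set.range (z * ·) := by
  classical
  have hu : Accepts credit u :=
    accepts_credit_of_append (accepts_word a) (h ▸ accepts_word b)
  have key : ∀ z w : _, word z = word b ++ w → ((∃ x, a * x = z) ↔ Accepts neutral (u ++ w)) := by
    intro z w hz
    rw [exists_mul_eq, hz, h, List.append_assoc]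
    constructor
    · rintro ⟨v, hv, e⟩
      rwa [List.append_cancel_left e]
    · exact fun hv => ⟨_, hv, rfl⟩
  rcases accepts_credit_cases hu with hu | rfl | hu
  · refine ⟨{b}, ?_⟩
    ext z
    simp only [Set.mem_inter_iff, Set.mem_range, Finset.mem_singleton, Set.iUnion_iUnion_eq_left,
      and_iff_right_iff_imp]
    rintro ⟨x, rfl⟩
    exact (key _ _ (word_mul b x)).2 (accepts_append hu (accepts_word x))
  · refine ⟨{b * c, b * d}, ?_⟩
    ext z
    simp only [Set.mem_inter_iff, Set.mem_range, Finset.mem_insert, Finset.mem_singleton,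
      Set.iUnion_iUnion_eq_or_left, Set.iUnion_iUnion_eq_left, Set.mem_union]
    constructor
    · rintro ⟨h1, x, rfl⟩
      rw [key _ _ (word_mul b x)] at h1
      rw [List.singleton_append] at h1
      obtain ⟨v, hv, e | e⟩ := accepts_zero_cons.1 h1
      · refine Or.inl (exists_mul_eq.2 ⟨v, hv, ?_⟩)
        rw [word_mul, word_mul, e, word_c, List.append_assoc, List.singleton_append]
      · refine Or.inr (exists_mul_eq.2 ⟨v, hv, ?_⟩)
        rw [word_mul, word_mul, e, word_d, List.append_assoc, List.singleton_append]
    · rintro (⟨x, rfl⟩ | ⟨x, rfl⟩)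
      · rw [mul_assoc]
        refine ⟨(key _ _ (word_mul b _)).2 ?_, _, rfl⟩
        rw [word_mul, word_c, List.singleton_append, List.singleton_append]
        exact accepts_zero_cons.2 ⟨word x, accepts_word x, Or.inl rfl⟩
      · rw [mul_assoc]
        refine ⟨(key _ _ (word_mul b _)).2 ?_, _, rfl⟩
        rw [word_mul, word_d, List.singleton_append, List.singleton_append]
        exact accepts_zero_cons.2 ⟨word x, accepts_word x, Or.inr rfl⟩
  · refine ⟨∅, ?_⟩
    ext z
    simp only [Set.mem_inter_iff, Set.mem_range, Finset.notMem_empty, Set.iUnion_of_empty,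
      Set.iUnion_empty, Set.mem_empty_iff_false, iff_false, not_and]
    rintro h1 ⟨x, rfl⟩
    exact hu _ ((key _ _ (word_mul b x)).1 h1)

theorem isFinitelyAligned : IsFinitelyAligned monoid := fun a b => by
  by_cases hz : ∃ z, z ∈ Set.range (a * ·) ∩ Set.range (b * ·)
  · obtain ⟨z, ⟨x, hx⟩, y, hy⟩ := hz
    have hxy : word a ++ word x = word b ++ word y := by
      rw [← word_mul, ← word_mul]
      exact congrArg word (hx.trans hy.symm)
    -- Two prefixes of one word are comparable.
    rcases List.append_eq_append_iff.1 hxy with ⟨u, hu, -⟩ | ⟨u, hu, -⟩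
    · exact range_inter_of_prefix hu
    · rw [Set.inter_comm]
      exact range_inter_of_prefix hu
  · refine ⟨∅, ?_⟩
    ext z
    simpa using fun x hx y hy => hz ⟨z, ⟨x, hx⟩, y, hy⟩

/-! ### The non-independent ideal and the pair $(hc,hd)$. -/

theorem mul_eq_mul {a b x y : monoid} :
    a * x = b * y ↔ word a ++ word x = word b ++ word y := by
  rw [← word_mul, ← word_mul]
  exact word_injective.eq_iff.symm

theorem mem_single_A {a b x : monoid} : x ∈ (Zigzag.single a b).A ↔ ∃ y, a * y = b * x := by
  simp [Zigzag.A, Zigzag.pull, leftDiv, leftMul]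

theorem A_eq_union : (Zigzag.single α₁ α₁h).A =
    (Zigzag.single c 1).A ∪ (Zigzag.single d 1).A := by
  ext x
  simp only [Set.mem_union, mem_single_A, exists_mul_eq, word_mul, word_one, word_α₁, word_α₁h,
    word_c, word_d, List.cons_append, List.nil_append, List.cons.injEq, true_and]
  have := accepts_zero_cons (w := word x)
  constructor
  · rintro ⟨u, hu, rfl⟩
    obtain ⟨v, hv, h | h⟩ := this.1 hu
    · exact Or.inl ⟨v, hv, h⟩
    · exact Or.inr ⟨v, hv, h⟩
  · rintro (⟨v, hv, h⟩ | ⟨v, hv, h⟩)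
    · exact ⟨_, this.2 ⟨v, hv, Or.inl h⟩, rfl⟩
    · exact ⟨_, this.2 ⟨v, hv, Or.inr h⟩, rfl⟩

theorem c_mem : c ∈ (Zigzag.single c 1).A := mem_single_A.2 ⟨1, by simp⟩

theorem d_mem : d ∈ (Zigzag.single d 1).A := mem_single_A.2 ⟨1, by simp⟩

theorem d_notMem : d ∉ (Zigzag.single c 1).A := by
  rw [mem_single_A, exists_mul_eq]
  simp [word_c, word_d]

theorem c_notMem : c ∉ (Zigzag.single d 1).A := by
  rw [mem_single_A, exists_mul_eq]
  simp [word_c, word_d]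

/-- The common prefixes of $hc$ and $hd$ are the empty word and $h$, and $h$ is not accepted. -/
theorem eq_one_of_mul_eq {b x y : monoid} (hx : b * x = hc) (hy : b * y = hd) : b = 1 := by
  have h1 := congrArg word hx
  have h2 := congrArg word hy
  have hb := accepts_word b
  rw [word_mul, word_hc] at h1
  rw [word_mul, word_hd] at h2
  refine word_injective (Eq.trans ?_ word_one.symm)
  rcases hw : word b with _ | ⟨i, _ | ⟨j, w⟩⟩
  · rfl
  · rw [hw] at h1 hb
    simp only [List.cons_append, List.cons.injEq] at h1
    rw [h1.1] at hb
    simp [Accepts, step] at hb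
  · rw [hw] at h1 h2
    simp only [List.cons_append, List.cons.injEq] at h1 h2
    exact absurd (h1.2.1.symm.trans h2.2.1) (by decide)

theorem not_injective_piS {π : CLi monoid →⋆ₙₐ[ℂ] CLiS monoid} (hπ : IsPiS π) :
    ¬ Function.Injective π := by
  -- Ending in $\alpha_2$ depends only on the last nontrivial factor, as the cocycle identity needs,
  -- and it separates $\alpha_2$ from $\alpha_1$.
  refine not_injective_of_isPiS (S := {a | (word a).getLast? = some 2}) (a₁ := α₁) (b₁ := α₁h)
    (a₂ := α₂) (b₂ := α₂h) (c := c) (d := d) (c' := hc) (d' := hd) ?_ ?_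
    (fun _ _ _ => eq_one_of_mul_eq) ?_ ?_ ?_ ?_ ?_ ?_ hπ
  · simp [word_one]
  · intro a b hb
    have hb' : word b ≠ [] := fun h => hb (word_injective (h.trans word_one.symm))
    simp [word_mul, List.getLast?_append_of_ne_nil _ hb']
  · simp [word_α₁]
  · simp [word_α₂]
  · intro h
    have := congrArg word (Prod.mk.inj h).1
    simp [word_c, word_hc] at this
  · simp [mul_eq_mul, word_α₁, word_α₁h, word_c, word_hc]
  · simp [mul_eq_mul, word_α₁, word_α₁h, word_d, word_hd]
  · intro x y
    simp [mul_eq_mul, word_α₁, word_α₁h, word_α₂, word_α₂h]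

end Example

end LiAlgebras

end

theorem proposition7p11 :
    (∃ (n : ℕ) (C : Submonoid (FreeGroup (Fin n))),
      LiAlgebras.IsFinitelyAligned C ∧ LiAlgebras.HasNoInverses C ∧
      (∃ π : LiAlgebras.CLi C →⋆ₙₐ[ℂ] LiAlgebras.CLiU C,
        LiAlgebras.IsPiU π ∧ ¬ Function.Injective π) ∧
      (∃ ρ : LiAlgebras.CLiS C →⋆ₙₐ[ℂ] LiAlgebras.CLiSU C,
        LiAlgebras.IsRhoU ρ ∧ ¬ Function.Injective ρ) ∧
      (∃ q : LiAlgebras.CZM C →⋆ₙₐ[ℂ] LiAlgebras.Toeplitz C,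
        LiAlgebras.IsQ q ∧ ¬ Function.Injective q)) ∧
    (∃ (n : ℕ) (C : Submonoid (FreeGroup (Fin n))),
      LiAlgebras.IsFinitelyAligned C ∧ LiAlgebras.HasNoInverses C ∧
      ∃ π : LiAlgebras.CLi C →⋆ₙₐ[ℂ] LiAlgebras.CLiS C,
        LiAlgebras.IsPiS π ∧ ¬ Function.Injective π) := by
  open LiAlgebras LiAlgebras.Example in
  obtain ⟨π, hπ⟩ := exists_isPiU monoid
  obtain ⟨ρ, hρ⟩ := exists_isRhoU monoid
  obtain ⟨q, hq⟩ := exists_isQ monoid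
  obtain ⟨π', hπ'⟩ := exists_isPiS monoid
  exact ⟨⟨5, monoid, isFinitelyAligned, hasNoInverses,
      ⟨π, hπ, not_injective_of_isPiU A_eq_union c_mem d_mem d_notMem c_notMem hπ⟩,
      ⟨ρ, hρ, not_injective_of_isRhoU A_eq_union c_mem d_mem d_notMem c_notMem hρ⟩,
      ⟨q, hq, not_injective_of_isQ A_eq_union c_mem d_mem d_notMem c_notMem hq⟩⟩,
    5, monoid, isFinitelyAligned, hasNoInverses, π', hπ', not_injective_piS hπ'⟩
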